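/- Let $K$ be an algebraically closed field with $\mathrm{char}\,K\neq 2$, let $r\ge 0$ be an integer and let $0\neq\delta\in K$. **Hyperoctahedral groups.** For $n\ge 0$ let $W_n$ be the group of permutations $\sigma$ of $\{-n,\dots,-1,1,\dots,n\}$ with $\sigma(-x)=-\sigma(x)$, and $\mathcal W_n=KW_n$. For $\sigma\in W_n$ put $\operatorname{sgn}\sigma=(-1)^{k}\operatorname{sgn}|\sigma|$, where $k=\#\{i>0:\sigma(i)<0\}$ and $|\sigma|\in\mathfrak S_n$ is the permutation $i\mapsto|\sigma(i)|$. A bipartition of $n$ is a pair $\pmb\lambda=(\lambda^1,\lambda^2)$ of partitions with $|\lambda^1|+|\lambda^2|=n$ (partitions that differ only by zero parts are identified). Write $\pmb\lambda\trianglerighteq\pmb\mu$ if for all $j$ both $\sum_{i\le j}\lambda^1_i\ge\sum_{i\le j}\mu^1_i$ and $|\lambda^1|+\sum_{i\le j}\lambda^2_i\ge|\mu^1|+\sum_{i\le j}\mu^2_i$. A $\pmb\lambda$-bitableau $\mathfrak t=(\mathfrak t^1,\mathfrak t^2)$ is a filling of the boxes of the Young diagrams of $\lambda^1,\lambda^2$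 by elements of $\{\pm1,\dots,\pm n\}$ with distinct absolute values; $W_n$ acts on bitableaux from the right through the entries. Let $R_{\mathfrak t}\subseteq W_n$ be the subgroup of elements that permute the entries within each row and may change signs of entries of $\mathfrak t^2$ only, and $C_{\mathfrak t}\subseteq W_n$ the subgroup of elements that permute the entries within each column and may change signs of entries of $\mathfrak t^1$ only. A bitabloid $\{\mathfrak t\}$ is a class for the relation $\mathfrak t\sim\mathfrak t\sigma$ ($\sigma\in R_{\mathfrak t}$). Let $M(\pmb\lambda)$ be the right $\mathcal W_n$-module with basis the bitabloids, let $S(\pmb\lambda)\subseteq M(\pmb\lambda)$ be the submodule spanned by all $\sum_{\sigma\in C_{\mathfrak t}}(\operatorname{sgn}\sigma)\{\mathfrak t\sigma\}$, and let $S'(\pmb\lambda)=\operatorname{Hom}_K(S(\pmb\lambda),K)$ with $(\varphi\sigma)(x)=\varphi(x\sigma^{-1})$ (the dual Specht module). **Brauer algebra of type $C$.** A Brauer diagram of type $C_r$ is a perfect matching of the $4r$ vertices of two rows, each labelled $-r,\dots,-1,1,\dots,r$, that is invariant under the reflection $x\mapsto -x$ of both rows. Let $B=\mathcal B(C_r,\delta)$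 be the $K$-algebra with these diagrams as a basis, the product of two diagrams being their concatenation (first factor on top), where each closed loop is replaced by a factor $\delta$. For $l\ge 0$ let $J_l$ be the two-sided ideal of $B$ generated by all diagrams with at least $l$ horizontal edges in the top row. For $0\le l\le r$ let $e_l=\delta^{-l}d_l$, where $d_l$ is the diagram with horizontal edges $\{-i,i\}$ $(1\le i\le l)$ in both rows and vertical edges joining $i$ to $i$ for $|i|>l$. The group $W_{r-l}$ embeds in $B$ as diagrams without horizontal edges that move only the outer vertices $\pm(l+1),\dots,\pm r$; it commutes with $e_l$ and hence acts from the left on the right $B$-module $e_l(B/J_{l+1})$. For a right $\mathcal W_{r-l}$-module $M$ put $\operatorname{ind}_l M=M\otimes_{\mathcal W_{r-l}}e_l(B/J_{l+1})$, a right $B$-module. **Order.** Let $\Lambda=\{(l,\pmb\lambda):0\le l\le r,\ \pmb\lambda\text{ a bipartition of }r-l\}$, partially ordered by: $(m,\pmb\mu)\ge(l,\pmb\lambda)$ if $m<l$, or $m=l$ and $\pmb\lambda\trianglerighteq\pmb\mu$. **Lemma.** If $(l,\pmb\lambda),(m,\pmb\mu)\in\Lambda$ and $(m,\pmb\mu)>(l,\pmb\lambda)$,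 then $$\operatorname{Hom}_B\bigl(\operatorname{ind}_l S'(\pmb\lambda),\operatorname{ind}_m S'(\pmb\mu)\bigr)=0 .$$ -/

import Mathlib

/-- A Brauer diagram with top row `V` (the vertices `inl v`) and bottom row `V` (the vertices
`inr v`): a partition of the vertices into pairs (edges), given by the map that sends each vertex
to the other end of its edge. -/
@[ext]
structure BrauerDiagram (V : Type*) where
  partner : V ⊕ V → V ⊕ V
  partner_partner : ∀ x, partner (partner x) = x
  partner_ne : ∀ x, partner x ≠ x

namespace BrauerDiagram

variable {V : Type*}

/-! The vertices `V ⊕ V ⊕ V` are those of two stacked diagrams: `inl` is the top row,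
`inr (inl _)` the middle row and `inr (inr _)` the bottom row. -/

/-- The other end of the edge of `d`, where `d` joins the top row and the middle row. -/
def upper (d : BrauerDiagram V) : V ⊕ V ⊕ V → V ⊕ V ⊕ V
  | .inl a => Sum.map id Sum.inl (d.partner (.inl a))
  | .inr (.inl b) => Sum.map id Sum.inl (d.partner (.inr b))
  | .inr (.inr c) => .inr (.inr c)

/-- The other end of the edge of `e`, where `e` joins the middle row and the bottom row. -/
def lower (e : BrauerDiagram V) : V ⊕ V ⊕ V → V ⊕ V ⊕ V
  | .inl a => .inl a
  | .inr x => .inr (e.partner x)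

/-- The top and bottom rows inside the three rows. -/
def outer : V ⊕ V → V ⊕ V ⊕ V := Sum.map id Sum.inr

/-- Connectedness in the graph obtained by putting `d` on top of `e`. -/
def stack (d e : BrauerDiagram V) : Setoid (V ⊕ V ⊕ V) :=
  Relation.EqvGen.setoid fun x y => y = d.upper x ∨ y = e.lower x

theorem stack_upper (d e : BrauerDiagram V) (x : V ⊕ V ⊕ V) : stack d e x (d.upper x) :=
  .rel _ _ (.inl rfl)

theorem stack_lower (d e : BrauerDiagram V) (x : V ⊕ V ⊕ V) : stack d e x (e.lower x) :=
  .rel _ _ (.inr rfl)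

theorem upper_up (d : BrauerDiagram V) (x : V ⊕ V) :
    d.upper (Sum.map id Sum.inl x) = Sum.map id Sum.inl (d.partner x) := by
  rcases x with a | b <;> rfl

theorem upper_upper (d : BrauerDiagram V) (x : V ⊕ V ⊕ V) : d.upper (d.upper x) = x := by
  rcases x with a | b | c
  · rw [show d.upper (.inl a) = Sum.map id Sum.inl (d.partner (.inl a)) from rfl, upper_up,
      d.partner_partner]; rfl
  · rw [show d.upper (.inr (.inl b)) = Sum.map id Sum.inl (d.partner (.inr b)) from rfl, upper_up,
      d.partner_partner]; rfl
  · rfl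

theorem lower_lower (d : BrauerDiagram V) (x : V ⊕ V ⊕ V) : d.lower (d.lower x) = x := by
  rcases x with a | x
  · rfl
  · simp [lower, d.partner_partner]

theorem upper_eq_iff (d : BrauerDiagram V) (x : V ⊕ V ⊕ V) :
    d.upper x = x ↔ ∃ c, x = .inr (.inr c) := by
  have inj : Function.Injective (Sum.map id Sum.inl : V ⊕ V → V ⊕ V ⊕ V) :=
    Function.injective_id.sumMap Sum.inl_injective
  rcases x with a | b | c
  · have h := inj.ne (d.partner_ne (.inl a))
    exact ⟨fun h' => (h h').elim, by rintro ⟨c, ⟨⟩⟩⟩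
  · have h := inj.ne (d.partner_ne (.inr b))
    exact ⟨fun h' => (h h').elim, by rintro ⟨c, ⟨⟩⟩⟩
  · simp [upper]

theorem lower_eq_iff (d : BrauerDiagram V) (x : V ⊕ V ⊕ V) :
    d.lower x = x ↔ ∃ c, x = .inl c := by
  rcases x with a | x
  · simp [lower]
  · simpa [lower] using d.partner_ne x

theorem exists_outer_iff (d e : BrauerDiagram V) (x : V ⊕ V ⊕ V) :
    (∃ y, x = outer y) ↔ d.upper x = x ∨ e.lower x = x := by
  rw [upper_eq_iff, lower_eq_iff]
  rcases x with a | b | c <;> simp [outer]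

/-- Two involutions of a finite set without common fixed point: the class of a point fixed by `b`
contains exactly one other point that is fixed by `a` or `b`. -/
theorem existsUnique_end {T : Type*} [Finite T] (a b : T → T) (ha : ∀ x, a (a x) = x)
    (hb : ∀ x, b (b x) = x) (hab : ∀ x, ¬ (a x = x ∧ b x = x)) (x : T) (hx : b x = x) :
    ∃! y, y ≠ x ∧ (a y = y ∨ b y = y) ∧
      Relation.EqvGen (fun x y => y = a x ∨ y = b x) x y := by
  set A : Equiv.Perm T := ⟨a, a, ha, ha⟩ with hA
  set B : Equiv.Perm T := ⟨b, b, hb, hb⟩ with hB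
  have hAA : A * A = 1 := by ext y; exact ha y
  have hBB : B * B = 1 := by ext y; exact hb y
  set P : Equiv.Perm T := A * B with hP
  have hPi : B * P * B = P⁻¹ := by
    rw [eq_inv_iff_mul_eq_one, hP]
    calc B * (A * B) * B * (A * B) = B * A * (B * B) * A * B := by group
      _ = B * (A * A) * B := by rw [hBB]; group
      _ = 1 := by rw [hAA]; simpa using hBB
  have hBinv : B⁻¹ = B := by rw [inv_eq_iff_mul_eq_one, hBB]
  have hBP : ∀ k : ℤ, B * P ^ k = P ^ (-k) * B := by
    intro k
    have h1 : B * P ^ k * B⁻¹ = (B * P * B⁻¹) ^ k := (conj_zpow).symm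
    rw [hBinv, hPi] at h1
    rw [zpow_neg, ← inv_zpow, ← h1, mul_assoc, hBB, mul_one]
  have hb' : ∀ k : ℤ, b ((P ^ k) x) = (P ^ (-k)) x := by
    intro k
    have := congrArg (fun f : Equiv.Perm T => f x) (hBP k)
    simp only [Equiv.Perm.mul_apply] at this
    rw [show B x = x from hx] at this
    exact this
  have ha' : ∀ k : ℤ, a ((P ^ k) x) = (P ^ (1 - k)) x := by
    intro k
    have h2 : A = P * B := by rw [hP, mul_assoc, hBB, mul_one]
    calc a ((P ^ k) x) = (P * B) ((P ^ k) x) := by rw [← h2]; rfl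
      _ = P (b ((P ^ k) x)) := rfl
      _ = (P ^ (1 - k)) x := by
        rw [hb', ← Equiv.Perm.mul_apply, ← zpow_one_add]; rfl
  have hcl : ∀ y z, Relation.EqvGen (fun x y => y = a x ∨ y = b x) y z →
      ((∃ k : ℤ, y = (P ^ k) x) ↔ ∃ k : ℤ, z = (P ^ k) x) := by
    intro y z h
    induction h with
    | rel y z h =>
      rcases h with rfl | rfl
      · constructor
        · rintro ⟨k, rfl⟩; exact ⟨1 - k, ha' k⟩
        · rintro ⟨k, hk⟩; exact ⟨1 - k, by rw [← ha', ← hk, ha]⟩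
      · constructor
        · rintro ⟨k, rfl⟩; exact ⟨- k, hb' k⟩
        · rintro ⟨k, hk⟩; exact ⟨- k, by rw [← hb', ← hk, hb]⟩
    | refl => rfl
    | symm _ _ _ ih => exact ih.symm
    | trans _ _ _ _ _ ih1 ih2 => exact ih1.trans ih2
  have hra : ∀ y, Relation.EqvGen (fun x y => y = a x ∨ y = b x) y (a y) :=
    fun y => .rel _ _ (.inl rfl)
  have hrb : ∀ y, Relation.EqvGen (fun x y => y = a x ∨ y = b x) y (b y) :=
    fun y => .rel _ _ (.inr rfl)
  have hP1 : ∀ y, Relation.EqvGen (fun x y => y = a x ∨ y = b x) y (P y) :=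
    fun y => .trans _ _ _ (hrb y) (hra (b y))
  have hPn : ∀ (k : ℕ) y, Relation.EqvGen (fun x y => y = a x ∨ y = b x) y ((P ^ k) y) := by
    intro k
    induction k with
    | zero => intro y; exact .refl _
    | succ k ih => intro y; rw [pow_succ]; exact .trans _ _ _ (hP1 y) (ih (P y))
  have hper : ∀ i j : ℤ, (P ^ i) x = (P ^ j) x ↔
      (Function.minimalPeriod (P • · : T → T) x : ℤ) ∣ i - j := by
    intro i j
    rw [← MulAction.zpow_smul_eq_iff_minimalPeriod_dvd, Equiv.Perm.smul_def,
      show i - j = -j + i by ring, zpow_add, zpow_neg, Equiv.Perm.mul_apply,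
      Equiv.Perm.inv_eq_iff_eq]
  have hpos : 0 < Function.minimalPeriod (P • · : T → T) x := by
    apply Function.minimalPeriod_pos_of_mem_periodicPts
    exact ⟨orderOf P, orderOf_pos P, by
      rw [Function.IsPeriodicPt, Function.IsFixedPt, smul_iterate, pow_orderOf_eq_one]; simp⟩
  set n := Function.minimalPeriod (P • · : T → T) x
  have hx0 : ∀ k : ℤ, (P ^ k) x = x ↔ (n : ℤ) ∣ k := by
    intro k
    simpa using hper k 0
  rcases Nat.even_or_odd' n with ⟨q, hq | hq⟩
  · have hbq : b ((P ^ (q : ℤ)) x) = (P ^ (q : ℤ)) x := by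
      rw [hb', hper]; exact ⟨-1, by rw [hq]; push_cast; ring⟩
    refine ⟨(P ^ (q : ℤ)) x, ⟨?_, .inr hbq, ?_⟩, ?_⟩
    · rw [Ne, hx0]
      intro h
      have := Int.le_of_dvd (by omega) h
      omega
    · rw [zpow_natCast]; exact hPn q x
    · rintro z ⟨hzx, hz, hxz⟩
      obtain ⟨k, rfl⟩ := (hcl _ _ hxz).1 ⟨0, by simp⟩
      rw [Ne, hx0] at hzx
      rw [ha', hb', hper, hper] at hz
      rw [hper]
      rcases hz with ⟨c, hc⟩ | ⟨c, hc⟩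
      · exfalso
        rw [hq] at hc
        push_cast at hc
        have : (1 : ℤ) = 2 * (q * c + k) := by linarith
        omega
      · rw [hq] at hc hzx ⊢
        push_cast at hc hzx ⊢
        have hk : k = q * (- c) := by linarith
        rcases Int.even_or_odd' c with ⟨e, rfl | rfl⟩
        · exact (hzx ⟨-e, by rw [hk]; ring⟩).elim
        · exact ⟨-e - 1, by rw [hk]; ring⟩
  · have hqa : a ((P ^ ((q + 1 : ℕ) : ℤ)) x) = (P ^ ((q + 1 : ℕ) : ℤ)) x := by
      rw [ha', hper]; exact ⟨-1, by rw [hq]; push_cast; ring⟩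
    refine ⟨(P ^ ((q + 1 : ℕ) : ℤ)) x, ⟨?_, .inl hqa, ?_⟩, ?_⟩
    · intro h
      rw [h] at hqa
      exact hab x ⟨hqa, hx⟩
    · rw [zpow_natCast]; exact hPn (q + 1) x
    · rintro z ⟨hzx, hz, hxz⟩
      obtain ⟨k, rfl⟩ := (hcl _ _ hxz).1 ⟨0, by simp⟩
      rw [Ne, hx0] at hzx
      rw [ha', hb', hper, hper] at hz
      rw [hper]
      have hcop : IsCoprime (n : ℤ) 2 := ⟨1, -q, by rw [hq]; push_cast; ring⟩
      rcases hz with ⟨c, hc⟩ | ⟨c, hc⟩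
      · refine hcop.dvd_of_dvd_mul_left (z := k - ((q + 1 : ℕ) : ℤ)) ⟨-c - 1, ?_⟩
        rw [hq] at hc ⊢
        push_cast at hc ⊢
        linear_combination -hc
      · exact (hzx (hcop.dvd_of_dvd_mul_left (z := k) ⟨-c, by linear_combination -hc⟩)).elim

theorem existsUnique_outer [Finite V] (d e : BrauerDiagram V) (x : V ⊕ V) :
    ∃! y, y ≠ x ∧ stack d e (outer x) (outer y) := by
  have inj : Function.Injective (outer : V ⊕ V → V ⊕ V ⊕ V) :=
    Function.injective_id.sumMap Sum.inr_injective
  have hno : ∀ z, ¬ (d.upper z = z ∧ e.lower z = z) := by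
    intro z
    rw [upper_eq_iff, lower_eq_iff]
    rintro ⟨⟨c, rfl⟩, ⟨c', ⟨⟩⟩⟩
  suffices h : ∃! y, y ≠ outer x ∧ (d.upper y = y ∨ e.lower y = y) ∧ stack d e (outer x) y by
    obtain ⟨y, ⟨h1, h2, h3⟩, h4⟩ := h
    obtain ⟨y, rfl⟩ := (exists_outer_iff d e y).2 h2
    refine ⟨y, ⟨fun h => h1 (by rw [h]), h3⟩, fun z hz => inj (h4 _ ⟨inj.ne hz.1, ?_, hz.2⟩)⟩
    exact (exists_outer_iff d e _).1 ⟨z, rfl⟩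
  rcases (exists_outer_iff d e (outer x)).1 ⟨x, rfl⟩ with h | h
  · have := existsUnique_end e.lower d.upper e.lower_lower d.upper_upper
      (fun z hz => hno z hz.symm) (outer x) h
    convert this using 4 with y
    · exact or_comm
    · rw [stack, Relation.EqvGen.setoid]
      simp only [or_comm]
  · exact existsUnique_end d.upper e.lower d.upper_upper e.lower_lower hno (outer x) h

/-- Concatenation of diagrams, `d` on top of `e`: every vertex of the outer rows is joined to the
unique other vertex of the outer rows in its connected component. -/
noncomputable def comp [Finite V] (d e : BrauerDiagram V) : BrauerDiagram V where
  partner x := (existsUnique_outer d e x).choose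
  partner_partner x := by
    have h := (existsUnique_outer d e x).choose_spec.1
    have h' := (existsUnique_outer d e (existsUnique_outer d e x).choose).choose_spec.2
    exact (h' x ⟨h.1.symm, (stack d e).symm h.2⟩).symm
  partner_ne x := (existsUnique_outer d e x).choose_spec.1.1

theorem stack_outer_iff [Finite V] (d e : BrauerDiagram V) (x y : V ⊕ V) :
    stack d e (outer x) (outer y) ↔ y = x ∨ y = (d.comp e).partner x := by
  have h := (existsUnique_outer d e x).choose_spec
  constructor
  · intro hxy
    by_cases hy : y = x
    · exact .inl hy
    · exact .inr (h.2 y ⟨hy, hxy⟩)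
  · rintro (rfl | rfl)
    · exact (stack d e).refl _
    · exact h.1.2

theorem comp_partner_eq_iff [Finite V] (d e : BrauerDiagram V) (x y : V ⊕ V) :
    (d.comp e).partner x = y ↔ y ≠ x ∧ stack d e (outer x) (outer y) := by
  rw [stack_outer_iff]
  constructor
  · rintro rfl
    exact ⟨(d.comp e).partner_ne x, .inr rfl⟩
  · rintro ⟨h, h' | h'⟩
    · exact (h h').elim
    · exact h'.symm

/-- The number of closed loops that are removed when `d` is put on top of `e`: the number of
connected components that lie in the middle row. -/
noncomputable def loops (d e : BrauerDiagram V) : ℕ :=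
  Nat.card {c : Quotient (stack d e) // ∀ x, Quotient.mk (stack d e) (outer x) ≠ c}

/-- Abstract form of the comparison of two ways to stack three diagrams. -/
theorem glue_equiv {T U Z O : Type*} (rT : T → T → Prop) (sU : Setoid U) (sZ : Setoid Z)
    (k : U → T) (h : Z → T) (i : O → U) (j : O → Z)
    (hk : Function.Injective k) (hh : Function.Injective h)
    (hcov : ∀ t, (∃ z, t = h z) ∨ ∃ u, t = k u)
    (hkh : ∀ u z, k u = h z → ∃ o, u = i o ∧ z = j o) (hij : ∀ o, k (i o) = h (j o))
    (hT : ∀ x y, rT x y →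
      (∃ u v, x = k u ∧ y = k v ∧ sU u v) ∨ ∃ z w, x = h z ∧ y = h w ∧ sZ z w)
    (hU : ∀ u v, sU u v → Relation.EqvGen rT (k u) (k v))
    (hZ : ∀ z w, sZ z w → Relation.EqvGen rT (h z) (h w))
    (hO : ∀ o o', sU (i o) (i o') → sZ (j o) (j o')) :
    ∃ E : Quotient sZ ⊕ {c : Quotient sU // ∀ o, Quotient.mk sU (i o) ≠ c} ≃
        Quotient (Relation.EqvGen.setoid rT),
      ∀ z, E (.inl (Quotient.mk sZ z)) = Quotient.mk _ (h z) := by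
  set sT := Relation.EqvGen.setoid rT with hsT
  -- invariant sets
  have inv : ∀ S : Set T,
      (∀ u v, sU u v → k u ∈ S → k v ∈ S) → (∀ z w, sZ z w → h z ∈ S → h w ∈ S) →
      ∀ x y, Relation.EqvGen rT x y → (x ∈ S ↔ y ∈ S) := by
    intro S h1 h2 x y hxy
    induction hxy with
    | rel x y hxy =>
      rcases hT x y hxy with ⟨u, v, rfl, rfl, huv⟩ | ⟨u, v, rfl, rfl, huv⟩
      · exact ⟨h1 _ _ huv, h1 _ _ (sU.symm huv)⟩
      · exact ⟨h2 _ _ huv, h2 _ _ (sZ.symm huv)⟩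
    | refl => rfl
    | symm _ _ _ ih => exact ih.symm
    | trans _ _ _ _ _ ih1 ih2 => exact ih1.trans ih2
  have invZ : ∀ z x y, Relation.EqvGen rT x y →
      (x ∈ {t | (∃ w, t = h w ∧ sZ z w) ∨ ∃ u o, t = k u ∧ sU u (i o) ∧ sZ z (j o)} ↔
        y ∈ {t | (∃ w, t = h w ∧ sZ z w) ∨ ∃ u o, t = k u ∧ sU u (i o) ∧ sZ z (j o)}) := by
    intro z
    apply inv
    · rintro u v huv (⟨w, hw, hzw⟩ | ⟨u', o, hu', huo, hzo⟩)
      · obtain ⟨o, rfl, rfl⟩ := hkh _ _ hw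
        exact .inr ⟨v, o, rfl, sU.symm huv, hzw⟩
      · obtain rfl := hk hu'
        exact .inr ⟨v, o, rfl, sU.trans (sU.symm huv) huo, hzo⟩
    · rintro w w' hww (⟨w1, hw, hzw⟩ | ⟨u', o, hu', huo, hzo⟩)
      · obtain rfl := hh hw
        exact .inl ⟨w', rfl, sZ.trans hzw hww⟩
      · obtain ⟨o', rfl, rfl⟩ := hkh _ _ hu'.symm
        exact .inl ⟨w', rfl, sZ.trans (sZ.trans hzo (sZ.symm (hO _ _ huo))) hww⟩
  have invU : ∀ u0, (∀ o, ¬ sU (i o) u0) → ∀ x y, Relation.EqvGen rT x y →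
      (x ∈ {t | ∃ u, t = k u ∧ sU u0 u} ↔ y ∈ {t | ∃ u, t = k u ∧ sU u0 u}) := by
    intro u0 hu0
    apply inv
    · rintro u v huv ⟨u', hu', huu⟩
      obtain rfl := hk hu'
      exact ⟨v, rfl, sU.trans huu huv⟩
    · rintro z w hzw ⟨u, hu, huu⟩
      obtain ⟨o, rfl, rfl⟩ := hkh _ _ hu.symm
      exact (hu0 o (sU.symm huu)).elim
  let G : Quotient sZ ⊕ {c : Quotient sU // ∀ o, Quotient.mk sU (i o) ≠ c} → Quotient sT :=
    Sum.elim (Quotient.map' h hZ) (fun c => Quotient.map' k hU c.1)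
  have hG : Function.Bijective G := by
    constructor
    · rintro (z | ⟨c, hc⟩) (w | ⟨c', hc'⟩) hzw
      · induction z using Quotient.ind with | _ z
        induction w using Quotient.ind with | _ w
        have hzw : Relation.EqvGen rT (h z) (h w) := Quotient.exact hzw
        rcases (invZ z _ _ hzw).1 (.inl ⟨z, rfl, sZ.refl z⟩) with ⟨w', hw, hzw'⟩ | ⟨u, o, hu, huo, hzo⟩
        · obtain rfl := hh hw
          exact congrArg _ (Quotient.sound hzw')
        · obtain ⟨o', rfl, rfl⟩ := hkh _ _ hu.symm
          exact congrArg _ (Quotient.sound (sZ.trans hzo (sZ.symm (hO _ _ huo))))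
      · exfalso
        induction z using Quotient.ind with | _ z
        induction c' using Quotient.ind with | _ u
        have hzw : Relation.EqvGen rT (h z) (k u) := Quotient.exact hzw
        have hu0 : ∀ o, ¬ sU (i o) u := fun o ho => hc' o (Quotient.sound ho)
        obtain ⟨v, hv, huv⟩ := (invU u hu0 _ _ hzw).2 ⟨u, rfl, sU.refl u⟩
        obtain ⟨o, rfl, rfl⟩ := hkh _ _ hv.symm
        exact hu0 o (sU.symm huv)
      · exfalso
        induction w using Quotient.ind with | _ z
        induction c using Quotient.ind with | _ u
        have hzw : Relation.EqvGen rT (k u) (h z) := Quotient.exact hzw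
        have hu0 : ∀ o, ¬ sU (i o) u := fun o ho => hc o (Quotient.sound ho)
        obtain ⟨v, hv, huv⟩ := (invU u hu0 _ _ hzw).1 ⟨u, rfl, sU.refl u⟩
        obtain ⟨o, rfl, rfl⟩ := hkh _ _ hv.symm
        exact hu0 o (sU.symm huv)
      · induction c using Quotient.ind with | _ u
        induction c' using Quotient.ind with | _ v
        have hzw : Relation.EqvGen rT (k u) (k v) := Quotient.exact hzw
        have hu0 : ∀ o, ¬ sU (i o) u := fun o ho => hc o (Quotient.sound ho)
        obtain ⟨v', hv, huv⟩ := (invU u hu0 _ _ hzw).1 ⟨u, rfl, sU.refl u⟩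
        obtain rfl := hk hv
        congr 2
        exact Quotient.sound huv
    · intro t
      induction t using Quotient.ind with | _ t
      rcases hcov t with ⟨z, rfl⟩ | ⟨u, rfl⟩
      · exact ⟨.inl (Quotient.mk _ z), rfl⟩
      · by_cases hu : ∃ o, sU (i o) u
        · obtain ⟨o, ho⟩ := hu
          refine ⟨.inl (Quotient.mk _ (j o)), ?_⟩
          refine (Quotient.sound ?_ : Quotient.mk sT (h (j o)) = Quotient.mk sT (k u))
          rw [← hij]
          exact hU _ _ ho
        · exact ⟨.inr ⟨Quotient.mk _ u, fun o ho => hu ⟨o, Quotient.exact ho⟩⟩, rfl⟩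
  exact ⟨Equiv.ofBijective G hG, fun z => rfl⟩

theorem stack_le (d e : BrauerDiagram V) (S : Setoid (V ⊕ V ⊕ V))
    (h1 : ∀ u : V ⊕ V, S (Sum.map id Sum.inl u) (Sum.map id Sum.inl (d.partner u)))
    (h2 : ∀ u : V ⊕ V, S (Sum.inr u) (Sum.inr (e.partner u))) (x y : V ⊕ V ⊕ V)
    (hxy : stack d e x y) : S x y := by
  have hxy : Relation.EqvGen (fun x y => y = d.upper x ∨ y = e.lower x) x y := hxy
  induction hxy with
  | rel x y h =>
    rcases h with rfl | rfl
    · rcases x with a | b | c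
      · exact h1 (.inl a)
      · exact h1 (.inr b)
      · exact S.refl _
    · rcases x with a | u
      · exact S.refl _
      · exact h2 u
  | refl => exact S.refl _
  | symm _ _ _ ih => exact S.symm (ih ‹_›)
  | trans _ _ _ _ _ ih1 ih2 => exact S.trans (ih1 ‹_›) (ih2 ‹_›)

theorem stack_up (d e : BrauerDiagram V) (u : V ⊕ V) :
    stack d e (Sum.map id Sum.inl u) (Sum.map id Sum.inl (d.partner u)) := by
  rw [← upper_up]
  exact stack_upper d e _

theorem stack_inr (d e : BrauerDiagram V) (u : V ⊕ V) :
    stack d e (Sum.inr u) (Sum.inr (e.partner u)) :=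
  stack_lower d e (.inr u)

/-- The edges of three stacked diagrams. -/
def Step4 (d e f : BrauerDiagram V) (x y : V ⊕ V ⊕ V ⊕ V) : Prop :=
  (∃ u, x = Sum.map id Sum.inl u ∧ y = Sum.map id Sum.inl (d.partner u)) ∨
  (∃ u, x = Sum.inr (Sum.map id Sum.inl u) ∧ y = Sum.inr (Sum.map id Sum.inl (e.partner u))) ∨
  ∃ u, x = Sum.inr (Sum.inr u) ∧ y = Sum.inr (Sum.inr (f.partner u))

theorem exists_equiv_left [Finite V] (d e f : BrauerDiagram V) :
    ∃ E : Quotient (stack (d.comp e) f) ⊕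
        {c : Quotient (stack d e) // ∀ o, Quotient.mk (stack d e) (outer o) ≠ c} ≃
        Quotient (Relation.EqvGen.setoid (Step4 d e f)),
      ∀ z, E (.inl (Quotient.mk _ z)) = Quotient.mk _ (Sum.map id Sum.inr z) := by
  have hU : ∀ u v, stack d e u v → Relation.EqvGen (Step4 d e f)
      (Sum.map id (Sum.map id Sum.inl) u) (Sum.map id (Sum.map id Sum.inl) v) := by
    apply stack_le d e (Setoid.comap _ (Relation.EqvGen.setoid (Step4 d e f)))
    · refine fun u => .rel _ _ (.inl ⟨u, ?_, ?_⟩)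
      · rcases u with u | u <;> rfl
      · rcases d.partner u with u | u <;> rfl
    · exact fun u => .rel _ _ (.inr (.inl ⟨u, rfl, rfl⟩))
  apply glue_equiv (Step4 d e f) (stack d e) (stack (d.comp e) f)
    (Sum.map id (Sum.map id Sum.inl)) (Sum.map id Sum.inr) outer (Sum.map id Sum.inl)
  · exact Function.injective_id.sumMap (Function.injective_id.sumMap Sum.inl_injective)
  · exact Function.injective_id.sumMap Sum.inr_injective
  · rintro (a | b | c | c)
    · exact .inl ⟨.inl a, rfl⟩
    · exact .inr ⟨.inr (.inl b), rfl⟩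
    · exact .inl ⟨.inr (.inl c), rfl⟩
    · exact .inl ⟨.inr (.inr c), rfl⟩
  · rintro (a | b | c) (a' | b' | c') h <;> simp at h
    · exact ⟨.inl a, rfl, by simp [h]⟩
    · exact ⟨.inr c, rfl, by simp [h]⟩
  · rintro (a | b) <;> rfl
  · rintro x y (⟨u, rfl, rfl⟩ | ⟨u, rfl, rfl⟩ | ⟨u, rfl, rfl⟩)
    · refine .inl ⟨_, _, ?_, ?_, stack_up d e u⟩
      · rcases u with u | u <;> rfl
      · rcases d.partner u with u | u <;> rfl
    · exact .inl ⟨_, _, rfl, rfl, stack_inr d e u⟩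
    · exact .inr ⟨_, _, rfl, rfl, stack_inr (d.comp e) f u⟩
  · exact hU
  · apply stack_le (d.comp e) f (Setoid.comap _ (Relation.EqvGen.setoid (Step4 d e f)))
    · intro u
      have h := hU _ _ ((stack_outer_iff d e u _).2 (.inr rfl))
      refine (Eq.mp ?_ h : Relation.EqvGen (Step4 d e f) _ _)
      congr 1
      · rcases u with u | u <;> rfl
      · rcases (d.comp e).partner u with u | u <;> rfl
    · exact fun u => .rel _ _ (.inr (.inr ⟨u, rfl, rfl⟩))
  · intro o o' h
    rcases (stack_outer_iff d e o o').1 h with rfl | rfl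
    · exact (stack (d.comp e) f).refl _
    · exact stack_up (d.comp e) f o

theorem exists_equiv_right [Finite V] (d e f : BrauerDiagram V) :
    ∃ E : Quotient (stack d (e.comp f)) ⊕
        {c : Quotient (stack e f) // ∀ o, Quotient.mk (stack e f) (outer o) ≠ c} ≃
        Quotient (Relation.EqvGen.setoid (Step4 d e f)),
      ∀ z, E (.inl (Quotient.mk _ z)) = Quotient.mk _ (Sum.map id outer z) := by
  have hU : ∀ u v, stack e f u v → Relation.EqvGen (Step4 d e f) (Sum.inr u) (Sum.inr v) := by
    apply stack_le e f (Setoid.comap Sum.inr (Relation.EqvGen.setoid (Step4 d e f)))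
    · exact fun u => .rel _ _ (.inr (.inl ⟨u, rfl, rfl⟩))
    · exact fun u => .rel _ _ (.inr (.inr ⟨u, rfl, rfl⟩))
  apply glue_equiv (Step4 d e f) (stack e f) (stack d (e.comp f))
    Sum.inr (Sum.map id outer) outer Sum.inr
  · exact Sum.inr_injective
  · exact Function.injective_id.sumMap (Function.injective_id.sumMap Sum.inr_injective)
  · rintro (a | u)
    · exact .inl ⟨.inl a, rfl⟩
    · exact .inr ⟨u, rfl⟩
  · rintro u (a | z) h <;> simp at h
    exact ⟨z, h, rfl⟩
  · intro o; rfl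
  · rintro x y (⟨u, rfl, rfl⟩ | ⟨u, rfl, rfl⟩ | ⟨u, rfl, rfl⟩)
    · refine .inr ⟨_, _, ?_, ?_, stack_up d (e.comp f) u⟩
      · rcases u with u | u <;> rfl
      · rcases d.partner u with u | u <;> rfl
    · exact .inl ⟨_, _, rfl, rfl, stack_up e f u⟩
    · exact .inl ⟨_, _, rfl, rfl, stack_inr e f u⟩
  · exact hU
  · apply stack_le d (e.comp f) (Setoid.comap _ (Relation.EqvGen.setoid (Step4 d e f)))
    · refine fun u => .rel _ _ (.inl ⟨u, ?_, ?_⟩)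
      · rcases u with u | u <;> rfl
      · rcases d.partner u with u | u <;> rfl
    · exact fun u => hU _ _ ((stack_outer_iff e f u _).2 (.inr rfl))
  · intro o o' h
    rcases (stack_outer_iff e f o o').1 h with rfl | rfl
    · exact (stack d (e.comp f)).refl _
    · exact stack_inr d (e.comp f) o

theorem card_of_equiv {X Q L T : Type*} [Finite Q] [Finite L] (E : Q ⊕ L ≃ T) (p : X → Q)
    (q : X → T) (h : ∀ x, E (.inl (p x)) = q x) :
    Nat.card {t : T // ∀ x, q x ≠ t} = Nat.card {c : Q // ∀ x, p x ≠ c} + Nat.card L := by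
  rw [← Nat.card_sum]
  have e1 : {t : T // ∀ x, q x ≠ t} ≃ {s : Q ⊕ L // ∀ x, .inl (p x) ≠ s} :=
    (E.subtypeEquiv fun s => by simp [← h]).symm
  have e2 : {b : L // ∀ x : X, (Sum.inl (p x) : Q ⊕ L) ≠ .inr b} ≃ L :=
    Equiv.subtypeUnivEquiv (by simp)
  have e3 : {c : Q // ∀ x : X, (Sum.inl (p x) : Q ⊕ L) ≠ .inl c} ≃ {c : Q // ∀ x, p x ≠ c} :=
    Equiv.subtypeEquivRight (by simp)
  exact Nat.card_congr (e1.trans (Equiv.subtypeSum.trans (e3.sumCongr e2)))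

theorem comp_assoc [Finite V] (d e f : BrauerDiagram V) :
    (d.comp e).comp f = d.comp (e.comp f) := by
  obtain ⟨E, hE⟩ := exists_equiv_left d e f
  obtain ⟨E', hE'⟩ := exists_equiv_right d e f
  have h : ∀ x y, stack (d.comp e) f (outer x) (outer y) ↔
      stack d (e.comp f) (outer x) (outer y) := by
    intro x y
    have hx : ∀ x : V ⊕ V, Sum.map id Sum.inr (outer x) = Sum.map id outer (outer x) := by
      rintro (a | a) <;> rfl
    rw [← Quotient.eq (r := stack (d.comp e) f), ← Quotient.eq (r := stack d (e.comp f)),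
      ← Sum.inl_injective.eq_iff, ← E.injective.eq_iff, hE, hE, hx, hx, ← hE', ← hE',
      E'.injective.eq_iff, Sum.inl_injective.eq_iff]
  ext1
  funext x
  rw [comp_partner_eq_iff, h, ← comp_partner_eq_iff]

theorem loops_add [Finite V] (d e f : BrauerDiagram V) :
    loops d e + loops (d.comp e) f = loops e f + loops d (e.comp f) := by
  obtain ⟨E, hE⟩ := exists_equiv_left d e f
  obtain ⟨E', hE'⟩ := exists_equiv_right d e f
  have h1 := card_of_equiv E (fun x : V ⊕ V => Quotient.mk _ (outer x)) _ (fun x => hE (outer x))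
  have h2 := card_of_equiv E' (fun x : V ⊕ V => Quotient.mk _ (outer x)) _ (fun x => hE' (outer x))
  have hx : ∀ x : V ⊕ V, Sum.map id Sum.inr (outer x) = Sum.map id outer (outer x) := by
    rintro (a | a) <;> rfl
  simp only [hx] at h1
  unfold loops
  omega

theorem comp_partner_map [Finite V] (d e : BrauerDiagram V) (s : V → V)
    (hs : Function.Injective s) (hd : ∀ x, d.partner (Sum.map s s x) = Sum.map s s (d.partner x))
    (he : ∀ x, e.partner (Sum.map s s x) = Sum.map s s (e.partner x)) (x : V ⊕ V) :
    (d.comp e).partner (Sum.map s s x) = Sum.map s s ((d.comp e).partner x) := by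
  rw [comp_partner_eq_iff]
  refine ⟨(hs.sumMap hs).ne ((d.comp e).partner_ne x), ?_⟩
  have key := stack_le d e (Setoid.comap (Sum.map s (Sum.map s s)) (stack d e)) (fun u => by
    have h := stack_up d e (Sum.map s s u)
    rw [hd] at h
    have hup : ∀ x : V ⊕ V, Sum.map s (Sum.map s s) (Sum.map id Sum.inl x) =
        Sum.map id Sum.inl (Sum.map s s x) := by
      rintro (a | a) <;> rfl
    rw [← hup, ← hup] at h
    exact h) (fun u => by
    have h := stack_inr d e (Sum.map s s u)
    rw [he] at h
    exact h) _ _ ((stack_outer_iff d e x _).2 (.inr rfl))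
  have hout : ∀ x : V ⊕ V, Sum.map s (Sum.map s s) (outer x) = outer (Sum.map s s x) := by
    rintro (a | a) <;> rfl
  rw [← hout, ← hout]
  exact key

/-- The diagram of a permutation, with vertical edges from `σ x` in the top row to `x` in the
bottom row. With this choice concatenation of diagrams is multiplication of permutations. -/
def ofPerm (σ : Equiv.Perm V) : BrauerDiagram V where
  partner := Sum.elim (fun y => .inr (σ.symm y)) (fun x => .inl (σ x))
  partner_partner := by rintro (x | x) <;> simp
  partner_ne := by rintro (x | x) <;> simp

theorem ofPerm_comp_partner [Finite V] (σ : Equiv.Perm V) (d : BrauerDiagram V) (x : V ⊕ V) :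
    ((ofPerm σ).comp d).partner (Sum.map σ id x) = Sum.map σ id (d.partner x) := by
  have key : ∀ x : V ⊕ V, stack (ofPerm σ) d (outer (Sum.map σ id x)) (.inr x) := by
    rintro (v | v)
    · exact (stack _ _).symm (stack_up (ofPerm σ) d (.inr v))
    · exact (stack _ _).refl _
  rw [comp_partner_eq_iff]
  refine ⟨(σ.injective.sumMap Function.injective_id).ne (d.partner_ne x), ?_⟩
  exact (stack _ _).trans (key x)
    ((stack _ _).trans (stack_inr (ofPerm σ) d x) ((stack _ _).symm (key _)))

theorem comp_ofPerm_partner [Finite V] (d : BrauerDiagram V) (σ : Equiv.Perm V) (x : V ⊕ V) :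
    (d.comp (ofPerm σ)).partner (Sum.map id σ.symm x) = Sum.map id σ.symm (d.partner x) := by
  have key : ∀ x : V ⊕ V,
      stack d (ofPerm σ) (outer (Sum.map id σ.symm x)) (Sum.map id Sum.inl x) := by
    rintro (v | v)
    · exact (stack _ _).refl _
    · exact (stack _ _).symm (stack_inr d (ofPerm σ) (.inl v))
  rw [comp_partner_eq_iff]
  refine ⟨(Function.injective_id.sumMap σ.symm.injective).ne (d.partner_ne x), ?_⟩
  exact (stack _ _).trans (key x)
    ((stack _ _).trans (stack_up d (ofPerm σ) x) ((stack _ _).symm (key _)))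

theorem loops_ofPerm_left (σ : Equiv.Perm V) (d : BrauerDiagram V) :
    loops (ofPerm σ) d = 0 := by
  rw [loops, Nat.card_eq_zero]
  refine .inl ⟨fun c => ?_⟩
  obtain ⟨c, hc⟩ := c
  induction c using Quotient.ind with | _ x
  rcases x with a | b | b
  · exact hc (.inl a) rfl
  · exact hc (.inl (σ b)) (Quotient.sound ((stack _ _).symm (stack_up (ofPerm σ) d (.inr b))))
  · exact hc (.inr b) rfl

theorem loops_ofPerm_right (d : BrauerDiagram V) (σ : Equiv.Perm V) :
    loops d (ofPerm σ) = 0 := by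
  rw [loops, Nat.card_eq_zero]
  refine .inl ⟨fun c => ?_⟩
  obtain ⟨c, hc⟩ := c
  induction c using Quotient.ind with | _ x
  rcases x with a | b | b
  · exact hc (.inl a) rfl
  · exact hc (.inr (σ.symm b))
      (Quotient.sound ((stack _ _).symm (stack_inr d (ofPerm σ) (.inl b))))
  · exact hc (.inr b) rfl

end BrauerDiagram

/-- The set `{-n, …, -1, 1, …, n}`, where `(i, ε)` stands for `ε * (i + 1)`. -/
abbrev Vertex (n : ℕ) : Type := Fin n × ℤˣ

/-- `x ↦ -x`, the reflection of a row of vertices in the vertical axis. -/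
def Vertex.neg {n : ℕ} (x : Vertex n) : Vertex n := (x.1, -x.2)

theorem Vertex.neg_neg {n : ℕ} (x : Vertex n) : x.neg.neg = x := by simp [Vertex.neg]

theorem Vertex.neg_injective {n : ℕ} : Function.Injective (Vertex.neg (n := n)) :=
  Function.Involutive.injective Vertex.neg_neg

/-- The hyperoctahedral group `W_n`: the permutations `σ` of `{-n, …, -1, 1, …, n}` with
`σ (-x) = -σ x`. -/
def Hyperoctahedral (n : ℕ) : Subgroup (Equiv.Perm (Vertex n)) where
  carrier := {σ | ∀ x : Vertex n, σ x.neg = (σ x).neg}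
  one_mem' _ := rfl
  mul_mem' {σ τ} hσ hτ x := by
    rw [Equiv.Perm.mul_apply, hτ x, hσ]; rfl
  inv_mem' {σ} hσ x := by
    rw [Equiv.Perm.inv_eq_iff_eq, hσ]; simp

/-- Brauer diagrams of type `C_r`: the Brauer diagrams on two rows of vertices
`-r, …, -1, 1, …, r` that are symmetric with respect to the vertical axis. -/
def DiagramC (r : ℕ) : Type :=
  {d : BrauerDiagram (Vertex r) //
    ∀ x, d.partner (Sum.map Vertex.neg Vertex.neg x) = Sum.map Vertex.neg Vertex.neg (d.partner x)}

namespace DiagramC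

variable {r : ℕ}

/-- Concatenation with closed loops removed. -/
noncomputable instance : Mul (DiagramC r) where
  mul d e := ⟨d.1.comp e.1, d.1.comp_partner_map e.1 _ Vertex.neg_injective d.2 e.2⟩

/-- The diagram without horizontal edges given by an element of the hyperoctahedral group. -/
def ofPerm (σ : Hyperoctahedral r) : DiagramC r where
  val := BrauerDiagram.ofPerm σ.1
  property := by
    rintro (x | x)
    · have h : (σ.1).symm x.neg = ((σ.1).symm x).neg := (σ⁻¹).2 x
      simp [BrauerDiagram.ofPerm, h]
    · simp [BrauerDiagram.ofPerm, σ.2 x]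

instance : One (DiagramC r) := ⟨ofPerm 1⟩

/-- The number of closed loops arising in the concatenation of `d` and `e`. -/
noncomputable def loops (d e : DiagramC r) : ℕ := d.1.loops e.1

noncomputable instance : Monoid (DiagramC r) where
  mul_assoc d e f := Subtype.ext (BrauerDiagram.comp_assoc d.1 e.1 f.1)
  one_mul d := by
    refine Subtype.ext (BrauerDiagram.ext (funext fun x => ?_))
    have h := BrauerDiagram.ofPerm_comp_partner 1 d.1 x
    rw [Equiv.Perm.coe_one, Sum.map_id_id, id, id] at h
    exact h
  mul_one d := by
    refine Subtype.ext (BrauerDiagram.ext (funext fun x => ?_))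
    have h := BrauerDiagram.comp_ofPerm_partner d.1 1 x
    rw [show (⇑(Equiv.symm (1 : Equiv.Perm (Vertex r)))) = id from rfl, Sum.map_id_id, id, id] at h
    exact h

theorem ofPerm_mul (σ τ : Hyperoctahedral r) : ofPerm σ * ofPerm τ = ofPerm (σ * τ) := by
  refine Subtype.ext (BrauerDiagram.ext (funext fun x => ?_))
  obtain ⟨y, rfl⟩ : ∃ y, x = Sum.map σ.1 id y := by
    rcases x with x | x
    · exact ⟨.inl (σ.1.symm x), by simp⟩
    · exact ⟨.inr x, rfl⟩
  refine (BrauerDiagram.ofPerm_comp_partner σ.1 (ofPerm τ).1 y).trans ?_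
  rcases y with v | v
  · change Sum.inr (τ.1.symm v) = Sum.inr ((σ.1 * τ.1).symm (σ.1 v))
    congr 1
    rw [Equiv.eq_symm_apply]
    simp
  · rfl

theorem loops_add (d e f : DiagramC r) :
    loops d e + loops (d * e) f = loops e f + loops d (e * f) :=
  BrauerDiagram.loops_add d.1 e.1 f.1

theorem loops_ofPerm_left (σ : Hyperoctahedral r) (d : DiagramC r) : loops (ofPerm σ) d = 0 :=
  BrauerDiagram.loops_ofPerm_left σ.1 d.1

theorem loops_ofPerm_right (d : DiagramC r) (σ : Hyperoctahedral r) : loops d (ofPerm σ) = 0 :=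
  BrauerDiagram.loops_ofPerm_right d.1 σ.1

theorem loops_one_left (d : DiagramC r) : loops 1 d = 0 := BrauerDiagram.loops_ofPerm_left 1 d.1

theorem loops_one_right (d : DiagramC r) : loops d 1 = 0 := BrauerDiagram.loops_ofPerm_right d.1 1

end DiagramC

/-- The Brauer algebra `B(C_r, δ)` of type `C`: the vector space with basis the Brauer diagrams of
type `C_r`, with product `d * e = δ ^ (number of closed loops) • (concatenation of d and e)`. -/
def BrauerC (K : Type*) [Field K] (r : ℕ) (_δ : K) : Type _ := DiagramC r →₀ K

namespace BrauerC

variable {K : Type*} [Field K] {r : ℕ} {δ : K}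

noncomputable instance : AddCommGroup (BrauerC K r δ) :=
  inferInstanceAs (AddCommGroup (DiagramC r →₀ K))

noncomputable instance : Module K (BrauerC K r δ) :=
  inferInstanceAs (Module K (DiagramC r →₀ K))

variable (δ) in
/-- The basis of diagrams. -/
noncomputable def basis : Module.Basis (DiagramC r) K (BrauerC K r δ) := ⟨LinearEquiv.refl K _⟩

variable (K r δ) in
/-- The multiplication of the Brauer algebra of type `C`, as a bilinear map. -/
noncomputable def mulMap : BrauerC K r δ →ₗ[K] BrauerC K r δ →ₗ[K] BrauerC K r δ :=
  (basis δ).constr K fun d => (basis δ).constr K fun e => δ ^ d.loops e • basis δ (d * e)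

noncomputable instance : Mul (BrauerC K r δ) := ⟨fun a b => mulMap K r δ a b⟩

noncomputable instance : One (BrauerC K r δ) := ⟨basis δ 1⟩

theorem mul_def (a b : BrauerC K r δ) : a * b = mulMap K r δ a b := rfl

theorem one_def : (1 : BrauerC K r δ) = basis δ 1 := rfl

theorem basis_mul_basis (d e : DiagramC r) :
    (basis δ d * basis δ e : BrauerC K r δ) = δ ^ d.loops e • basis δ (d * e) := by
  rw [mul_def, mulMap, Module.Basis.constr_basis, Module.Basis.constr_basis]

noncomputable instance : Ring (BrauerC K r δ) where
  __ := (inferInstance : AddCommGroup (BrauerC K r δ))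
  left_distrib a b c := (mulMap K r δ a).map_add b c
  right_distrib a b c := (mulMap K r δ).map_add₂ a b c
  zero_mul a := (mulMap K r δ).map_zero₂ a
  mul_zero a := (mulMap K r δ a).map_zero
  one_mul a := by
    have h : mulMap K r δ 1 = LinearMap.id := (basis δ).ext fun d => by
      rw [← mul_def, one_def, basis_mul_basis, DiagramC.loops_one_left]; simp
    exact congrArg (· a) h
  mul_one a := by
    have h : (mulMap K r δ).flip 1 = LinearMap.id := (basis δ).ext fun d => by
      rw [LinearMap.flip_apply, ← mul_def, one_def, basis_mul_basis, DiagramC.loops_one_right]; simp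
    exact congrArg (· a) h
  mul_assoc a b c := by
    have h : (mulMap K r δ).compr₂ (mulMap K r δ) =
        (LinearMap.lcomp K _ (mulMap K r δ) ∘ₗ LinearMap.llcomp K _ _ _) ∘ₗ mulMap K r δ := by
      refine (basis δ).ext fun d => (basis δ).ext fun e => (basis δ).ext fun f => ?_
      change basis δ d * basis δ e * basis δ f = basis δ d * (basis δ e * basis δ f)
      rw [basis_mul_basis, basis_mul_basis]
      simp only [mul_def, map_smul, LinearMap.smul_apply]
      simp only [← mul_def]
      rw [basis_mul_basis, basis_mul_basis, smul_smul, smul_smul, ← pow_add, ← pow_add,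
        DiagramC.loops_add, mul_assoc]
    exact congrArg (fun F => F a b c) h

noncomputable instance : Algebra K (BrauerC K r δ) :=
  Algebra.ofModule (fun k a b => (mulMap K r δ).map_smul₂ k a b)
    (fun k a b => (mulMap K r δ a).map_smul k b)

end BrauerC

namespace Vertex

/-- `x ↦ ε x` for a sign `ε`. -/
def scale {n : ℕ} (ε : ℤˣ) (x : Vertex n) : Vertex n := (x.1, ε * x.2)

theorem scale_one {n : ℕ} (x : Vertex n) : scale 1 x = x := by simp [scale]

theorem scale_scale {n : ℕ} (ε ε' : ℤˣ) (x : Vertex n) :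
    scale ε (scale ε' x) = scale (ε * ε') x := by simp [scale, mul_assoc]

theorem eq_scale {n : ℕ} (x : Vertex n) : x = scale x.2 (x.1, 1) := by simp [scale]

end Vertex

namespace Hyperoctahedral

variable {n : ℕ}

theorem apply_scale (σ : Hyperoctahedral n) (ε : ℤˣ) (x : Vertex n) :
    σ.1 (x.scale ε) = (σ.1 x).scale ε := by
  rcases Int.units_eq_one_or ε with rfl | rfl
  · simp [Vertex.scale]
  · have h := σ.2 x
    simpa [Vertex.scale, Vertex.neg] using h

theorem apply_fst (σ : Hyperoctahedral n) (x : Vertex n) : (σ.1 x).1 = (σ.1 (x.1, 1)).1 := by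
  conv_lhs => rw [x.eq_scale, apply_scale]
  rfl

theorem apply_snd (σ : Hyperoctahedral n) (x : Vertex n) :
    (σ.1 x).2 = x.2 * (σ.1 (x.1, 1)).2 := by
  conv_lhs => rw [x.eq_scale, apply_scale]
  rfl

/-- The permutation of `{1, …, n}` induced by a signed permutation, `i ↦ |σ i|`. -/
def abs : Hyperoctahedral n →* Equiv.Perm (Fin n) where
  toFun σ :=
    { toFun := fun i => (σ.1 (i, 1)).1
      invFun := fun i => ((σ⁻¹).1 (i, 1)).1
      left_inv := fun i => by
        change ((σ⁻¹).1 ((σ.1 (i, 1)).1, 1)).1 = i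
        rw [← apply_fst]
        simp
      right_inv := fun i => by
        change (σ.1 (((σ⁻¹).1 (i, 1)).1, 1)).1 = i
        rw [← apply_fst]
        simp }
  map_one' := rfl
  map_mul' σ τ := by
    ext i : 1
    change ((σ * τ).1 (i, 1)).1 = (σ.1 ((τ.1 (i, 1)).1, 1)).1
    rw [← apply_fst]
    rfl

theorem abs_apply (σ : Hyperoctahedral n) (i : Fin n) : abs σ i = (σ.1 (i, 1)).1 := rfl

/-- The sign of `σ = ξ σ'`, where `σ'` permutes `{1, …, n}` and `ξ` is a product of `k` sign changes:
`(-1) ^ k * sign σ'`. -/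
def sgn : Hyperoctahedral n →* ℤˣ where
  toFun σ := (∏ i, (σ.1 (i, 1)).2) * Equiv.Perm.sign (abs σ)
  map_one' := by simp
  map_mul' σ τ := by
    have h : ∀ i, ((σ * τ).1 (i, 1)).2 = (τ.1 (i, 1)).2 * (σ.1 (abs τ i, 1)).2 := fun i =>
      apply_snd σ (τ.1 (i, 1))
    simp only [h, map_mul, Finset.prod_mul_distrib,
      Equiv.prod_comp (abs τ) fun i => (σ.1 (i, 1)).2]
    ac_rfl

/-- Given a filling `f` of the set `S` of boxes, the elements `σ` of the hyperoctahedral group which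
permute the entries of each line of `S`, up to signs that lie in `E`. -/
def linePerms (S : Finset (ℕ × ℕ)) (line : ℕ × ℕ → ℕ) (E : Subgroup ℤˣ) (f : S → Vertex n) :
    Subgroup (Hyperoctahedral n) where
  carrier := {σ | ∃ π : Equiv.Perm S, ∀ b, line (π b) = line b ∧
    ∃ ε ∈ E, σ.1 (f b) = (f (π b)).scale ε}
  one_mem' := ⟨1, fun b => ⟨rfl, 1, E.one_mem, by rw [Vertex.scale_one]; rfl⟩⟩
  mul_mem' := by
    rintro σ τ ⟨π, hπ⟩ ⟨π', hπ'⟩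
    refine ⟨π * π', fun b => ⟨(hπ _).1.trans (hπ' b).1, ?_⟩⟩
    obtain ⟨ε', hε', h'⟩ := (hπ' b).2
    obtain ⟨ε, hε, h⟩ := (hπ (π' b)).2
    refine ⟨ε' * ε, E.mul_mem hε' hε, ?_⟩
    change σ.1 (τ.1 (f b)) = _
    rw [h', apply_scale, h, Vertex.scale_scale]
    rfl
  inv_mem' := by
    rintro σ ⟨π, hπ⟩
    refine ⟨π⁻¹, fun b => ?_⟩
    obtain ⟨h1, ε, hε, h⟩ := hπ (π⁻¹ b)
    rw [show π (π⁻¹ b) = b from π.apply_symm_apply b] at h1 h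
    refine ⟨h1.symm, ε⁻¹, E.inv_mem hε, ?_⟩
    change (σ.1)⁻¹ (f b) = _
    rw [Equiv.Perm.inv_eq_iff_eq, apply_scale, h, Vertex.scale_scale, inv_mul_cancel,
      Vertex.scale_one]

theorem mem_linePerms_conj (S : Finset (ℕ × ℕ)) (line : ℕ × ℕ → ℕ) (E : Subgroup ℤˣ)
    (f : S → Vertex n) (σ τ : Hyperoctahedral n) :
    σ ∈ linePerms S line E (fun b => (τ⁻¹).1 (f b)) ↔ τ * σ * τ⁻¹ ∈ linePerms S line E f := by
  refine exists_congr fun π => forall_congr' fun b => and_congr_right fun _ =>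
    exists_congr fun ε => and_congr_right fun _ => ?_
  rw [← apply_scale]
  change _ ↔ τ.1 (σ.1 ((τ⁻¹).1 (f b))) = _
  change _ = (τ.1)⁻¹ _ ↔ _
  rw [Equiv.Perm.eq_inv_iff_eq]

end Hyperoctahedral

/-- A bipartition of `n`: a pair of partitions, given by their Young diagrams, with `n` boxes in
total. -/
@[ext]
structure Bipartition (n : ℕ) where
  left : YoungDiagram
  right : YoungDiagram
  card_add_card : left.card + right.card = n

namespace Bipartition

/-- The dominance order on bipartitions, `lam ⊵ mu`. (The sizes `n` and `n'` are allowed to be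
different variables only in order to avoid casts; the relation is used for `n = n'`.) -/
def Dominates {n n' : ℕ} (lam : Bipartition n) (mu : Bipartition n') : Prop :=
  (∀ j, ∑ i ∈ Finset.range j, mu.left.rowLen i ≤ ∑ i ∈ Finset.range j, lam.left.rowLen i) ∧
  ∀ j, mu.left.card + ∑ i ∈ Finset.range j, mu.right.rowLen i ≤
    lam.left.card + ∑ i ∈ Finset.range j, lam.right.rowLen i

theorem eq_of_sum_rowLen {mu nu : YoungDiagram}
    (h : ∀ j, ∑ i ∈ Finset.range j, mu.rowLen i = ∑ i ∈ Finset.range j, nu.rowLen i) :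
    mu = nu := by
  have h' : ∀ i, mu.rowLen i = nu.rowLen i := fun i => by
    have h1 := h (i + 1)
    rw [Finset.sum_range_succ, Finset.sum_range_succ, h i] at h1
    exact Nat.add_left_cancel h1
  ext ⟨i, j⟩
  rw [YoungDiagram.mem_cells, YoungDiagram.mem_cells, YoungDiagram.mem_iff_lt_rowLen, h',
    ← YoungDiagram.mem_iff_lt_rowLen]

theorem Dominates.antisymm {n : ℕ} {lam mu : Bipartition n} (h : lam.Dominates mu)
    (h' : mu.Dominates lam) : lam = mu := by
  have h1 : lam.left = mu.left := eq_of_sum_rowLen fun j => (h'.1 j).antisymm (h.1 j)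
  have h2 : lam.right = mu.right := eq_of_sum_rowLen fun j => by
    have := (h'.2 j).antisymm (h.2 j)
    rw [h1] at this
    exact Nat.add_left_cancel this
  exact Bipartition.ext h1 h2

end Bipartition

/-- A bitableau of shape `lam`: a filling of the boxes by elements of `{-n, …, -1, 1, …, n}` whose
absolute values are distinct. -/
@[ext]
structure BiTableau {n : ℕ} (lam : Bipartition n) where
  left : lam.left.cells → Vertex n
  right : lam.right.cells → Vertex n
  injective : Function.Injective (Sum.elim (fun b => (left b).1) (fun b => (right b).1))

namespace BiTableau

variable {n : ℕ} {lam : Bipartition n}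

/-- The right action of the hyperoctahedral group on bitableaux. Here `x · σ = σ⁻¹ x` on entries,
which is the vertex of the bottom row that is joined to `x` in the diagram of `σ`. -/
def act (t : BiTableau lam) (σ : Hyperoctahedral n) : BiTableau lam where
  left b := (σ⁻¹).1 (t.left b)
  right b := (σ⁻¹).1 (t.right b)
  injective := by
    have h := (Hyperoctahedral.abs σ⁻¹).injective.comp t.injective
    convert h using 1
    funext b
    rcases b with b | b <;> exact Hyperoctahedral.apply_fst _ _

theorem act_one (t : BiTableau lam) : t.act 1 = t := rfl

theorem act_mul (t : BiTableau lam) (σ τ : Hyperoctahedral n) :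
    t.act (σ * τ) = (t.act σ).act τ := by
  ext1 <;> funext b <;> simp [act]

/-- The row permutations of `t`: they permute the entries of each row, and may change signs of the
entries of the second tableau. -/
def rowGroup (t : BiTableau lam) : Subgroup (Hyperoctahedral n) :=
  Hyperoctahedral.linePerms lam.left.cells Prod.fst ⊥ t.left ⊓
    Hyperoctahedral.linePerms lam.right.cells Prod.fst ⊤ t.right

/-- The column permutations of `t`: they permute the entries of each column, and may change signs of
the entries of the first tableau. -/
def colGroup (t : BiTableau lam) : Subgroup (Hyperoctahedral n) :=
  Hyperoctahedral.linePerms lam.left.cells Prod.snd ⊤ t.left ⊓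
    Hyperoctahedral.linePerms lam.right.cells Prod.snd ⊥ t.right

theorem mem_rowGroup_act (t : BiTableau lam) (σ τ : Hyperoctahedral n) :
    σ ∈ (t.act τ).rowGroup ↔ τ * σ * τ⁻¹ ∈ t.rowGroup :=
  and_congr (Hyperoctahedral.mem_linePerms_conj _ _ _ _ _ _)
    (Hyperoctahedral.mem_linePerms_conj _ _ _ _ _ _)

theorem mem_colGroup_act (t : BiTableau lam) (σ τ : Hyperoctahedral n) :
    σ ∈ (t.act τ).colGroup ↔ τ * σ * τ⁻¹ ∈ t.colGroup :=
  and_congr (Hyperoctahedral.mem_linePerms_conj _ _ _ _ _ _)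
    (Hyperoctahedral.mem_linePerms_conj _ _ _ _ _ _)

/-- Row equivalence of bitableaux. -/
def rowEquiv (lam : Bipartition n) : Setoid (BiTableau lam) where
  r t t' := ∃ σ ∈ t.rowGroup, t' = t.act σ
  iseqv :=
    { refl := fun t => ⟨1, t.rowGroup.one_mem, t.act_one.symm⟩
      symm := by
        rintro t _ ⟨σ, hσ, rfl⟩
        refine ⟨σ⁻¹, ?_, by rw [← act_mul, mul_inv_cancel, act_one]⟩
        rw [mem_rowGroup_act]
        simpa using hσ
      trans := by
        rintro t _ _ ⟨σ, hσ, rfl⟩ ⟨τ, hτ, rfl⟩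
        refine ⟨σ * τ, ?_, (act_mul _ _ _).symm⟩
        rw [mem_rowGroup_act] at hτ
        simpa using t.rowGroup.mul_mem hτ hσ }

end BiTableau

/-- Bitabloids: row equivalence classes of bitableaux. -/
def BiTabloid {n : ℕ} (lam : Bipartition n) : Type := Quotient (BiTableau.rowEquiv lam)

namespace BiTabloid

variable {n : ℕ} {lam : Bipartition n}

/-- The bitabloid of a bitableau. -/
def mk (t : BiTableau lam) : BiTabloid lam := Quotient.mk (BiTableau.rowEquiv lam) t

open MulOpposite in
/-- The right action of the hyperoctahedral group on bitabloids. -/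
instance : MulAction (Hyperoctahedral n)ᵐᵒᵖ (BiTabloid lam) where
  smul σ := Quotient.map (fun t => t.act (unop σ)) (by
    rintro t _ ⟨ρ, hρ, rfl⟩
    refine ⟨(unop σ)⁻¹ * ρ * unop σ, ?_, ?_⟩
    · rw [BiTableau.mem_rowGroup_act]
      simpa [mul_assoc] using hρ
    · rw [← BiTableau.act_mul, ← BiTableau.act_mul]
      congr 1
      group)
  one_smul x := by
    induction x using Quotient.ind with | _ t
    rfl
  mul_smul σ τ x := by
    induction x using Quotient.ind with | _ t
    exact congrArg mk (t.act_mul (unop τ) (unop σ))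

theorem op_smul_mk (σ : Hyperoctahedral n) (t : BiTableau lam) :
    MulOpposite.op σ • mk t = mk (t.act σ) := rfl

end BiTabloid

/-! Right modules over the group algebra of `W_n` are representations of the opposite group. -/

section Specht

variable (K : Type*) [Field K] {n : ℕ}

/-- The permutation module `M(lam)`, with basis the bitabloids. -/
noncomputable def permutationModule (lam : Bipartition n) :
    Representation K (Hyperoctahedral n)ᵐᵒᵖ (BiTabloid lam →₀ K) where
  toFun σ := Finsupp.lmapDomain K K (σ • ·)
  map_one' := Finsupp.lhom_ext fun x a => by simp
  map_mul' σ τ := Finsupp.lhom_ext fun x a => by simp [mul_smul]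

theorem permutationModule_single {lam : Bipartition n} (σ : (Hyperoctahedral n)ᵐᵒᵖ)
    (x : BiTabloid lam) (a : K) :
    permutationModule K lam σ (Finsupp.single x a) = Finsupp.single (σ • x) a :=
  Finsupp.mapDomain_single

open scoped Classical in
/-- The polytabloid `e_t = ∑ σ, sgn σ • {t · σ}`, the sum being over the column permutations. -/
noncomputable def polytabloid {lam : Bipartition n} (t : BiTableau lam) : BiTabloid lam →₀ K :=
  ∑ σ : t.colGroup, Finsupp.single (BiTabloid.mk (t.act σ)) ((Hyperoctahedral.sgn σ.1 : ℤ) : K)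

theorem permutationModule_polytabloid {lam : Bipartition n} (t : BiTableau lam)
    (τ : Hyperoctahedral n) :
    permutationModule K lam (MulOpposite.op τ) (polytabloid K t) = polytabloid K (t.act τ) := by
  classical
  rw [polytabloid, polytabloid, map_sum]
  refine Fintype.sum_equiv
    ((MulAut.conj τ⁻¹).toEquiv.subtypeEquiv fun σ => ?_) _ _ fun σ => ?_
  · rw [BiTableau.mem_colGroup_act]
    simp [mul_assoc]
  · rw [permutationModule_single, BiTabloid.op_smul_mk]
    congr 2
    · rw [← BiTableau.act_mul, ← BiTableau.act_mul]
      simp [mul_assoc]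
    · have h : Hyperoctahedral.sgn (τ⁻¹ * σ.1 * τ) = Hyperoctahedral.sgn σ.1 := by
        rw [map_mul, map_mul, map_inv, mul_comm, mul_inv_cancel_left]
      rw [← h]
      simp

/-- The Specht module inside the permutation module: the span of all polytabloids. -/
noncomputable def spechtSubrepresentation (lam : Bipartition n) :
    Subrepresentation (permutationModule K lam) where
  toSubmodule := Submodule.span K (Set.range (polytabloid K))
  apply_mem_toSubmodule g v hv := by
    induction hv using Submodule.span_induction with
    | mem x hx =>
      obtain ⟨t, rfl⟩ := hx
      exact Submodule.subset_span
        ⟨t.act g.unop, (permutationModule_polytabloid K t g.unop).symm⟩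
    | zero => simp
    | add x y _ _ hx hy => rw [map_add]; exact Submodule.add_mem _ hx hy
    | smul a x _ hx => rw [map_smul]; exact Submodule.smul_mem _ a hx

/-- The Specht module `S(lam)`. -/
noncomputable def spechtModule (lam : Bipartition n) :
    Representation K (Hyperoctahedral n)ᵐᵒᵖ (spechtSubrepresentation K lam).toSubmodule :=
  (spechtSubrepresentation K lam).toRepresentation

/-- The dual Specht module `S'(lam)`, with `(φ · σ) m = φ (m · σ⁻¹)`. -/
noncomputable def dualSpechtModule (lam : Bipartition n) :
    Representation K (Hyperoctahedral n)ᵐᵒᵖ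
      (Module.Dual K (spechtSubrepresentation K lam).toSubmodule) :=
  (spechtModule K lam).dual

end Specht

/-- The index set of the cell modules: the pairs `(l, lam)` with `0 ≤ l ≤ r` and `lam` a bipartition
of `r - l`. -/
@[ext]
structure CellIndex (r : ℕ) where
  layer : ℕ
  layer_le : layer ≤ r
  shape : Bipartition (r - layer)

/-- The order on the index set: `(m, mu) ≥ (l, lam)` if `m < l`, or `m = l` and `lam ⊵ mu`. -/
instance (r : ℕ) : PartialOrder (CellIndex r) where
  le x y := y.layer < x.layer ∨ (x.layer = y.layer ∧ x.shape.Dominates y.shape)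
  le_refl x := .inr ⟨rfl, fun _ => le_rfl, fun _ => le_rfl⟩
  le_trans x y z := by
    rintro (h | ⟨h, h1, h2⟩) (h' | ⟨h', h1', h2'⟩)
    · exact .inl (h'.trans h)
    · exact .inl (h' ▸ h)
    · exact .inl (h ▸ h')
    · exact .inr ⟨h.trans h', fun j => (h1' j).trans (h1 j), fun j => (h2' j).trans (h2 j)⟩
  le_antisymm := by
    rintro ⟨l, hl, lam⟩ ⟨m, hm, mu⟩ (h | ⟨h, h1⟩) (h' | ⟨h', h1'⟩)
    · exact (lt_asymm h h').elim
    · exact (h.ne h').elim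
    · exact (h'.ne h).elim
    · obtain rfl : l = m := h
      obtain rfl := h1.antisymm h1'
      rfl


namespace DiagramC

variable {r : ℕ}

open scoped Classical in
/-- The number of horizontal edges in the top row (which is the number of those in the bottom
row). -/
noncomputable def numArcs (d : DiagramC r) : ℕ :=
  (Finset.univ.filter fun v : Vertex r => ∃ w, d.1.partner (.inl v) = .inl w).card / 2

/-- The diagram with horizontal edges `{-i, i}`, for `1 ≤ i ≤ l`, in both rows, and vertical edges
from `i` to `i` for all other vertices `i`. -/
def arcs (r l : ℕ) : DiagramC r where
  val :=
    { partner := fun x => x.elim (fun v => if v.1.1 < l then .inl v.neg else .inr v)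
        (fun v => if v.1.1 < l then .inr v.neg else .inl v)
      partner_partner := by
        rintro (v | v) <;> by_cases h : v.1.1 < l <;> simp [h, Vertex.neg]
      partner_ne := by
        rintro (v | v) <;> by_cases h : v.1.1 < l <;>
          simp [h, Vertex.neg, Prod.ext_iff, (units_ne_neg_self _).symm] }
  property := by
    rintro (v | v) <;> by_cases h : v.1.1 < l <;> simp [h, Vertex.neg]

end DiagramC

/-- The inclusion of `{±1, …, ±(r - l)}` as the outer vertices `{±(l + 1), …, ±r}` of a row. -/
def Vertex.shift (r l : ℕ) : Vertex (r - l) ↪ Vertex r where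
  toFun x := (⟨x.1.1 + l, by have := x.1.2; omega⟩, x.2)
  inj' := by
    rintro ⟨i, s⟩ ⟨j, t⟩ h
    simp only [Prod.mk.injEq, Fin.mk.injEq, add_left_inj] at h
    exact Prod.ext (Fin.ext h.1) h.2

theorem Vertex.mem_range_shift {r l : ℕ} (x : Vertex r) :
    x ∈ Set.range (Vertex.shift r l) ↔ l ≤ x.1.1 := by
  constructor
  · rintro ⟨y, rfl⟩
    exact Nat.le_add_left _ _
  · intro h
    refine ⟨(⟨x.1.1 - l, by have := x.1.2; omega⟩, x.2), Prod.ext (Fin.ext ?_) rfl⟩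
    exact Nat.sub_add_cancel h

/-- The embedding of `W_{r - l}` into `W_r` as the elements that only move the outer vertices
`±(l + 1), …, ±r`. -/
noncomputable def Hyperoctahedral.extend (r l : ℕ) : Hyperoctahedral (r - l) →* Hyperoctahedral r :=
  ((Equiv.Perm.viaEmbeddingHom (Vertex.shift r l)).comp (Hyperoctahedral (r - l)).subtype).codRestrict
    (Hyperoctahedral r) fun σ x => by
      change σ.1.viaEmbedding (Vertex.shift r l) x.neg = (σ.1.viaEmbedding (Vertex.shift r l) x).neg
      by_cases hx : x ∈ Set.range (Vertex.shift r l)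
      · obtain ⟨y, rfl⟩ := hx
        rw [show (Vertex.shift r l y).neg = Vertex.shift r l y.neg from rfl,
          Equiv.Perm.viaEmbedding_apply, Equiv.Perm.viaEmbedding_apply, σ.2 y]
        rfl
      · rw [Equiv.Perm.viaEmbedding_apply_of_notMem _ _ _ hx,
          Equiv.Perm.viaEmbedding_apply_of_notMem]
        rw [Vertex.mem_range_shift] at hx ⊢
        exact hx

theorem Hyperoctahedral.extend_apply_of_lt {r l : ℕ} (σ : Hyperoctahedral (r - l)) (x : Vertex r)
    (hx : x.1.1 < l) : (extend r l σ).1 x = x :=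
  Equiv.Perm.viaEmbedding_apply_of_notMem _ _ _ (by
    rw [Vertex.mem_range_shift]
    omega)

theorem Hyperoctahedral.le_extend_apply {r l : ℕ} (σ : Hyperoctahedral (r - l)) (x : Vertex r)
    (hx : l ≤ x.1.1) : l ≤ ((extend r l σ).1 x).1.1 := by
  obtain ⟨y, rfl⟩ := (Vertex.mem_range_shift x).2 hx
  change l ≤ (σ.1.viaEmbedding (Vertex.shift r l) _).1.1
  rw [Equiv.Perm.viaEmbedding_apply]
  exact Nat.le_add_left _ _

theorem DiagramC.ofPerm_mul_arcs {r l : ℕ} (σ : Hyperoctahedral (r - l)) :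
    ofPerm (Hyperoctahedral.extend r l σ) * arcs r l =
      arcs r l * ofPerm (Hyperoctahedral.extend r l σ) := by
  set s := Hyperoctahedral.extend r l σ with hs
  have hlt : ∀ x : Vertex r, x.1.1 < l → s.1 x = x := Hyperoctahedral.extend_apply_of_lt σ
  have hge : ∀ x : Vertex r, l ≤ x.1.1 → l ≤ (s.1 x).1.1 := Hyperoctahedral.le_extend_apply σ
  refine Subtype.ext (BrauerDiagram.ext (funext fun x => ?_))
  obtain ⟨y, rfl⟩ : ∃ y, x = Sum.map s.1 id y := by
    rcases x with x | x
    · exact ⟨.inl (s.1.symm x), by simp⟩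
    · exact ⟨.inr x, rfl⟩
  refine (BrauerDiagram.ofPerm_comp_partner s.1 (arcs r l).1 y).trans ?_
  have hA : ∀ y, (arcs r l).1.partner (Sum.map s.1 s.1 y) =
      Sum.map s.1 s.1 ((arcs r l).1.partner y) := by
    rintro (v | v) <;> by_cases hv : v.1.1 < l
    · simp [arcs, hv, hlt v hv, hlt v.neg hv]
    · simp [arcs, hv, (hge v (not_lt.1 hv)).not_gt]
    · simp [arcs, hv, hlt v hv, hlt v.neg hv]
    · simp [arcs, hv, (hge v (not_lt.1 hv)).not_gt]
  have hs : ∀ y : Vertex r ⊕ Vertex r,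
      Sum.map id s.1.symm (Sum.map s.1 s.1 y) = Sum.map s.1 id y := by
    rintro (v | v) <;> simp
  have h2 := BrauerDiagram.comp_ofPerm_partner (arcs r l).1 s.1 (Sum.map s.1 s.1 y)
  rw [hA, hs, hs] at h2
  exact h2.symm

namespace BrauerC

variable (K : Type*) [Field K] (r : ℕ) (δ : K)

/-- The two-sided ideal `J_l` generated by all diagrams with at least `l` horizontal edges. -/
noncomputable def J (l : ℕ) : TwoSidedIdeal (BrauerC K r δ) :=
  TwoSidedIdeal.span {x | ∃ d : DiagramC r, l ≤ d.numArcs ∧ x = basis δ d}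

/-- `J_l` as a right submodule; right modules over `B` are modules over `Bᵐᵒᵖ`. -/
noncomputable def rightJ (l : ℕ) : Submodule (BrauerC K r δ)ᵐᵒᵖ (BrauerC K r δ) where
  carrier := {x | x ∈ J K r δ l}
  add_mem' := (J K r δ l).add_mem
  zero_mem' := (J K r δ l).zero_mem
  smul_mem' b _ hx := (J K r δ l).mul_mem_right _ b.unop hx

/-- The element `e_l`, an idempotent if `δ ≠ 0`. -/
noncomputable def idem (l : ℕ) : BrauerC K r δ := (δ ^ l)⁻¹ • basis δ (DiagramC.arcs r l)

/-- Left multiplication by `b` on `B / J_l`. -/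
noncomputable def leftMul (l : ℕ) (b : BrauerC K r δ) :
    BrauerC K r δ ⧸ rightJ K r δ l →ₗ[(BrauerC K r δ)ᵐᵒᵖ] BrauerC K r δ ⧸ rightJ K r δ l :=
  (rightJ K r δ l).mapQ (rightJ K r δ l)
    { toFun := fun x => b * x
      map_add' := mul_add b
      map_smul' := fun c x => (mul_assoc b x c.unop).symm }
    fun x hx => (J K r δ l).mul_mem_left b x hx

/-- The right `B`-module `e_l (B / J_{l+1})`, as a submodule of `B / J_{l+1}`. -/
noncomputable def layerModule (l : ℕ) :
    Submodule (BrauerC K r δ)ᵐᵒᵖ (BrauerC K r δ ⧸ rightJ K r δ (l + 1)) :=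
  LinearMap.range (leftMul K r δ (l + 1) (idem K r δ l))

/-- The image of an element of `W_{r - l}` in `B`, acting on the outer vertices. -/
noncomputable def ofHyperoctahedral (l : ℕ) (σ : Hyperoctahedral (r - l)) : BrauerC K r δ :=
  basis δ (DiagramC.ofPerm (Hyperoctahedral.extend r l σ))

theorem ofHyperoctahedral_mul (l : ℕ) (σ τ : Hyperoctahedral (r - l)) :
    ofHyperoctahedral K r δ l (σ * τ) =
      ofHyperoctahedral K r δ l σ * ofHyperoctahedral K r δ l τ := by
  rw [ofHyperoctahedral, ofHyperoctahedral, ofHyperoctahedral, basis_mul_basis,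
    DiagramC.loops_ofPerm_left, DiagramC.ofPerm_mul, map_mul, pow_zero, one_smul]

theorem ofHyperoctahedral_mul_idem (l : ℕ) (σ : Hyperoctahedral (r - l)) :
    ofHyperoctahedral K r δ l σ * idem K r δ l = idem K r δ l * ofHyperoctahedral K r δ l σ := by
  rw [idem, mul_smul_comm, smul_mul_assoc, ofHyperoctahedral, basis_mul_basis, basis_mul_basis,
    DiagramC.ofPerm_mul_arcs, DiagramC.loops_ofPerm_left, DiagramC.loops_ofPerm_right]

/-- The right `B`-module `e_l (B / J_{l+1})`, as a type. -/
def Layer (l : ℕ) : Type _ := layerModule K r δ l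

noncomputable instance (l : ℕ) : AddCommGroup (Layer K r δ l) :=
  inferInstanceAs (AddCommGroup (layerModule K r δ l))

noncomputable instance (l : ℕ) : Module (BrauerC K r δ)ᵐᵒᵖ (Layer K r δ l) :=
  inferInstanceAs (Module (BrauerC K r δ)ᵐᵒᵖ (layerModule K r δ l))

noncomputable instance (l : ℕ) : Module K (Layer K r δ l) :=
  inferInstanceAs (Module K (layerModule K r δ l))

instance (l : ℕ) : IsScalarTower K (BrauerC K r δ)ᵐᵒᵖ (Layer K r δ l) :=
  inferInstanceAs (IsScalarTower K (BrauerC K r δ)ᵐᵒᵖ (layerModule K r δ l))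

instance (l : ℕ) : SMulCommClass K (BrauerC K r δ)ᵐᵒᵖ (Layer K r δ l) :=
  inferInstanceAs (SMulCommClass K (BrauerC K r δ)ᵐᵒᵖ (layerModule K r δ l))

/-- The left action of `W_{r - l}` on `e_l (B / J_{l+1})`: as `W_{r - l}` commutes with `e_l`, it is
given by left multiplication. It commutes with the right action of `B`. -/
noncomputable def layerAct (l : ℕ) (σ : Hyperoctahedral (r - l)) :
    Layer K r δ l →ₗ[(BrauerC K r δ)ᵐᵒᵖ] Layer K r δ l :=
  (leftMul K r δ (l + 1) (ofHyperoctahedral K r δ l σ)).restrict (by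
    rintro _ ⟨x, rfl⟩
    induction x using Submodule.Quotient.induction_on with | _ x
    refine ⟨Submodule.Quotient.mk (ofHyperoctahedral K r δ l σ * x), ?_⟩
    refine congrArg (Submodule.Quotient.mk (p := rightJ K r δ (l + 1))) ?_
    change idem K r δ l * (ofHyperoctahedral K r δ l σ * x) =
      ofHyperoctahedral K r δ l σ * (idem K r δ l * x)
    rw [← mul_assoc, ← mul_assoc, ofHyperoctahedral_mul_idem])

section ind

variable {r}
open scoped TensorProduct

/-- The relations `(v · σ) ⊗ x = v ⊗ σ x` (with the two factors interchanged), which define the tensor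
product over the group algebra of `W_{r - l}` as a quotient of the tensor product over `K`. Their
span over `K` is stable under `B`, so it does not matter that the span is taken over `B`. -/
noncomputable def balanced (l : ℕ) {V : Type*} [AddCommGroup V] [Module K V]
    (ρ : Representation K (Hyperoctahedral (r - l))ᵐᵒᵖ V) :
    Submodule (BrauerC K r δ)ᵐᵒᵖ (Layer K r δ l ⊗[K] V) :=
  Submodule.span _ {z | ∃ x v σ, z = x ⊗ₜ[K] ρ (MulOpposite.op σ) v - layerAct K r δ l σ x ⊗ₜ[K] v}

/-- The right `B`-module `ind_l V = V ⊗ e_l (B / J_{l+1})`, the tensor product being over the group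
algebra of `W_{r - l}`, for a right module `V` over this group algebra. (The factors are written in
the opposite order, so that `B` acts on the first one.) -/
abbrev ind (l : ℕ) {V : Type*} [AddCommGroup V] [Module K V]
    (ρ : Representation K (Hyperoctahedral (r - l))ᵐᵒᵖ V) : Type _ :=
  (Layer K r δ l ⊗[K] V) ⧸ balanced K δ l ρ

end ind

end BrauerC

/-- The cell module `ind_l S'(lam)` of `B(C_r, δ)`. -/
abbrev CellModule (K : Type*) [Field K] {r : ℕ} (δ : K) (x : CellIndex r) : Type _ :=
  BrauerC.ind K δ x.layer (dualSpechtModule K x.shape)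

/-!
The dual Specht module `S'(λ)` is spanned by the functionals which read off the coefficient of a
bitabloid `{s}`. For an intertwiner `F : S'(λ) → S'(μ)`, apply the image of this functional to a
polytabloid `e_t` of shape `μ`. The resulting scalar is turned into its negative by an odd element
of `R_s ∩ C_t`, and also by changing the sign of an entry that `s¹` and `t²` share. In
characteristic `≠ 2` it therefore vanishes unless the components of `s` and `t` have the same
entries, up to sign, and no row of `s` meets a column of `t` twice. Counting the entries in the
first `j` rows of `s` by the columns of `t` which contain them then gives `μ ⊵ λ`.

Intertwiners arise from `B`-homomorphisms by truncation with `e_l`: `(ind_l V) e_l` is `V ⊗ e_l`, a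
copy of `V`, because a diagram with the horizontal edges of `e_l` in both rows either has further
ones or is the diagram of `e_l` times an element of `W_{r-l}`. As `V ⊗ e_l` generates `ind_l V`, a
nonzero homomorphism from `ind_l V` to `ind_l V'` restricts to a nonzero intertwiner from `V` to
`V'`. For `m < l` there is no nonzero homomorphism to `ind_m U`, as `e_l` lies in `J_{m+1}`, which
annihilates `ind_m U`, but fixes the generators of `ind_l V`.
-/

theorem card_filter_fst_lt (ν : YoungDiagram) (j : ℕ) :
    (ν.cells.filter (·.1 < j)).card = ∑ i ∈ Finset.range j, ν.rowLen i := by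
  rw [Finset.card_eq_sum_card_fiberwise (f := Prod.fst) (t := Finset.range j)
    fun x hx => Finset.mem_coe.2 (Finset.mem_range.2 (Finset.mem_filter.1 hx).2)]
  refine Finset.sum_congr rfl fun i hi => ?_
  rw [YoungDiagram.rowLen_eq_card, YoungDiagram.row, Finset.filter_filter]
  exact congrArg _ (Finset.filter_congr fun x _ =>
    ⟨And.right, fun h => ⟨h ▸ Finset.mem_range.1 hi, h⟩⟩)

theorem card_filter_fst_lt_snd_eq (ν : YoungDiagram) (j c : ℕ) :
    ((ν.cells.filter (·.1 < j)).filter (·.2 = c)).card = min j (ν.colLen c) := by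
  have hcells : (ν.cells.filter (·.1 < j)).filter (·.2 = c) =
      (Finset.range (min j (ν.colLen c))).image fun i => (i, c) := by
    ext ⟨a, b⟩
    simp only [Finset.mem_filter, Finset.mem_image, Finset.mem_range, lt_min_iff, Prod.mk.injEq,
      YoungDiagram.mem_cells, YoungDiagram.mem_iff_lt_colLen]
    aesop
  rw [hcells, Finset.card_image_of_injective _ (Prod.mk_left_injective c), Finset.card_range]

theorem card_le_sum_rowLen {ν : YoungDiagram} {S : Finset (ℕ × ℕ)} (hS : S ⊆ ν.cells) {j : ℕ}
    (hj : ∀ c, (S.filter (·.2 = c)).card ≤ j) :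
    S.card ≤ ∑ i ∈ Finset.range j, ν.rowLen i := by
  rw [← card_filter_fst_lt,
    Finset.card_eq_sum_card_fiberwise (f := Prod.snd) (t := ν.cells.image Prod.snd)
      fun x hx => Finset.mem_coe.2 (Finset.mem_image_of_mem _ (hS hx)),
    Finset.card_eq_sum_card_fiberwise (f := Prod.snd) (t := ν.cells.image Prod.snd)
      fun x hx => Finset.mem_coe.2 (Finset.mem_image_of_mem _ (Finset.mem_filter.1 hx).1)]
  refine Finset.sum_le_sum fun c _ => ?_
  rw [card_filter_fst_lt_snd_eq]
  refine le_min (hj c) ?_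
  rw [YoungDiagram.colLen_eq_card]
  exact Finset.card_le_card (Finset.filter_subset_filter _ hS)

/-- No two entries in the same row of the filling `f` lie in the same column of the filling `g`. -/
def RowColumnDisjoint {ι : Type*} {ν μ : YoungDiagram} (f : ν.cells → ι) (g : μ.cells → ι) : Prop :=
  ∀ p q p' q', f p = g p' → f q = g q' → p.1.1 = q.1.1 → p'.1.2 = q'.1.2 → p = q

theorem sum_rowLen_le_of_rowColumnDisjoint {ι : Type*} {ν μ : YoungDiagram} {f : ν.cells → ι}
    {g : μ.cells → ι} (hf : Function.Injective f) (hfg : Set.range f ⊆ Set.range g)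
    (h : RowColumnDisjoint f g) (j : ℕ) :
    ∑ i ∈ Finset.range j, ν.rowLen i ≤ ∑ i ∈ Finset.range j, μ.rowLen i := by
  obtain ⟨φ, rfl⟩ := Set.range_subset_range_iff_exists_comp.1 hfg
  have φ_injective : Function.Injective fun p => (φ p).1 :=
    Subtype.val_injective.comp hf.of_comp
  set topRows : Finset ν.cells := Finset.univ.filter (·.1.1 < j) with topRows_def
  have card_topRows : topRows.card = ∑ i ∈ Finset.range j, ν.rowLen i := by
    rw [← card_filter_fst_lt, ← Finset.card_map (Function.Embedding.subtype _), topRows_def]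
    congr 1
    ext x
    simp only [Finset.mem_map, Finset.mem_filter, Finset.mem_univ, true_and,
      Function.Embedding.subtype_apply, Subtype.exists, exists_and_right, exists_eq_right]
    tauto
  rw [← card_topRows, ← Finset.card_image_of_injective topRows φ_injective]
  refine card_le_sum_rowLen (Finset.image_subset_iff.2 fun p _ => (φ p).2) fun c => ?_
  rw [Finset.filter_image, Finset.card_image_of_injective _ φ_injective, ← Finset.card_range j]
  refine Finset.card_le_card_of_injOn (fun p => p.1.1) (fun p hp => ?_) fun p hp q hq hpq => ?_
  · have := (Finset.mem_filter.1 (Finset.mem_filter.1 hp).1).2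
    simpa using this
  · exact h p q (φ p) (φ q) rfl rfl hpq
      ((Finset.mem_filter.1 hp).2.trans (Finset.mem_filter.1 hq).2.symm)

namespace Vertex

variable {n : ℕ}

theorem exists_eq_scale {v w : Vertex n} (h : v.1 = w.1) : ∃ ε, v = w.scale ε :=
  ⟨v.2 * w.2, Prod.ext h (by simp [scale, mul_assoc])⟩

end Vertex

namespace Hyperoctahedral

variable {n : ℕ}

/-- The signed permutation `i ↦ ε i * π i` for `i > 0`. -/
def ofSigns (π : Equiv.Perm (Fin n)) (ε : Fin n → ℤˣ) : Hyperoctahedral n where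
  val :=
    { toFun := fun x => (π x.1, ε x.1 * x.2)
      invFun := fun x => (π⁻¹ x.1, ε (π⁻¹ x.1) * x.2)
      left_inv := fun x => by simp [← mul_assoc]
      right_inv := fun x => by simp [← mul_assoc] }
  property x := by simp [Vertex.neg]

theorem ofSigns_apply (π : Equiv.Perm (Fin n)) (ε : Fin n → ℤˣ) (x : Vertex n) :
    (ofSigns π ε).1 x = (π x.1, ε x.1 * x.2) := rfl

theorem sgn_ofSigns (π : Equiv.Perm (Fin n)) (ε : Fin n → ℤˣ) :
    sgn (ofSigns π ε) = (∏ i, ε i) * Equiv.Perm.sign π := by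
  have habs : abs (ofSigns π ε) = π := rfl
  change (∏ i, ((ofSigns π ε).1 (i, 1)).2) * Equiv.Perm.sign (abs (ofSigns π ε)) = _
  simp only [habs, ofSigns_apply, mul_one]

/-- The reflection that interchanges `i` and `-i`. -/
def signChange (i : Fin n) : Hyperoctahedral n :=
  ofSigns 1 (Pi.mulSingle i (-1))

theorem sgn_signChange (i : Fin n) : sgn (signChange i) = -1 := by
  rw [signChange, sgn_ofSigns, Fintype.prod_pi_mulSingle', Equiv.Perm.sign_one, mul_one]

theorem signChange_apply_fst (i : Fin n) (x : Vertex n) : ((signChange i).1 x).1 = x.1 := rfl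

theorem signChange_apply_of_ne {i : Fin n} {x : Vertex n} (h : x.1 ≠ i) :
    (signChange i).1 x = x := by
  simp [signChange, ofSigns_apply, h]

/-- The signed permutation that interchanges `a` and `b` and fixes all vertices other than `±a` and
`±b`. It is meant for vertices with different absolute values. -/
def signedSwap (a b : Vertex n) : Hyperoctahedral n :=
  ofSigns (Equiv.swap a.1 b.1) (Pi.mulSingle a.1 (a.2 * b.2) * Pi.mulSingle b.1 (a.2 * b.2))

theorem signedSwap_left {a b : Vertex n} (hab : a.1 ≠ b.1) : (signedSwap a b).1 a = b :=
  Prod.ext (Equiv.swap_apply_left _ _) (by simp [signedSwap, ofSigns_apply, hab, mul_right_comm])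

theorem signedSwap_right {a b : Vertex n} (hab : a.1 ≠ b.1) : (signedSwap a b).1 b = a :=
  Prod.ext (Equiv.swap_apply_right _ _)
    (by simp [signedSwap, ofSigns_apply, hab.symm, mul_assoc])

theorem signedSwap_of_ne {a b x : Vertex n} (ha : x.1 ≠ a.1) (hb : x.1 ≠ b.1) :
    (signedSwap a b).1 x = x :=
  Prod.ext (Equiv.swap_apply_of_ne_of_ne ha hb) (by simp [signedSwap, ofSigns_apply, ha, hb])

theorem sgn_signedSwap {a b : Vertex n} (hab : a.1 ≠ b.1) : sgn (signedSwap a b) = -1 := by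
  simp only [signedSwap, sgn_ofSigns, Equiv.Perm.sign_swap hab, Pi.mul_apply,
    Finset.prod_mul_distrib, Fintype.prod_pi_mulSingle', Int.units_mul_self, one_mul]

section linePerms

variable {S : Finset (ℕ × ℕ)} {line : ℕ × ℕ → ℕ} {E : Subgroup ℤˣ} {f : S → Vertex n}

theorem mem_linePerms_of_fixed {σ : Hyperoctahedral n} (hσ : ∀ b, σ.1 (f b) = f b) :
    σ ∈ linePerms S line E f :=
  ⟨1, fun b => ⟨rfl, 1, E.one_mem, by rw [hσ, Vertex.scale_one]; rfl⟩⟩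

theorem mem_linePerms_top {σ : Hyperoctahedral n} (hσ : ∀ b, (σ.1 (f b)).1 = (f b).1) :
    σ ∈ linePerms S line ⊤ f :=
  ⟨1, fun b => ⟨rfl, (Vertex.exists_eq_scale (hσ b)).imp fun _ h => ⟨Subgroup.mem_top _, h⟩⟩⟩

theorem signedSwap_mem_linePerms (hf : Function.Injective fun b => (f b).1) {p q : S}
    (hpq : line p = line q) {ε ε' : ℤˣ} (hε : ε ∈ E) (hε' : ε' ∈ E)
    (hab : (f p).1 ≠ (f q).1) :
    signedSwap ((f p).scale ε) ((f q).scale ε') ∈ linePerms S line E f := by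
  classical
  have hab' : ((f p).scale ε).1 ≠ ((f q).scale ε').1 := hab
  have self_eq_scale (ε : ℤˣ) (x : Vertex n) : x = (x.scale ε).scale ε := by
    rw [Vertex.scale_scale, Int.units_mul_self, Vertex.scale_one]
  refine ⟨Equiv.swap p q, fun c => ?_⟩
  rcases eq_or_ne c p with rfl | hcp
  · refine ⟨by rw [Equiv.swap_apply_left, hpq], ε * ε', E.mul_mem hε hε', ?_⟩
    rw [Equiv.swap_apply_left, self_eq_scale ε (f c), apply_scale, ← self_eq_scale,
      signedSwap_left hab', Vertex.scale_scale]
  rcases eq_or_ne c q with rfl | hcq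
  · refine ⟨by rw [Equiv.swap_apply_right, hpq], ε' * ε, E.mul_mem hε' hε, ?_⟩
    rw [Equiv.swap_apply_right, self_eq_scale ε' (f c), apply_scale, ← self_eq_scale,
      signedSwap_right hab', Vertex.scale_scale]
  · rw [Equiv.swap_apply_of_ne_of_ne hcp hcq]
    exact ⟨rfl, 1, E.one_mem, by
      rw [signedSwap_of_ne (a := (f p).scale ε) (b := (f q).scale ε') (fun h => hcp (hf h))
        fun h => hcq (hf h), Vertex.scale_one]⟩

theorem exists_inv_apply_fst_eq_iff {σ : Hyperoctahedral n} (hσ : σ ∈ linePerms S line E f)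
    (i : Fin n) : (∃ b, ((σ⁻¹).1 (f b)).1 = i) ↔ ∃ b, (f b).1 = i := by
  obtain ⟨π, hπ⟩ := (linePerms S line E f).inv_mem hσ
  have h : ∀ b, ((σ⁻¹).1 (f b)).1 = (f (π b)).1 := fun b => by
    obtain ⟨-, ε, -, h⟩ := hπ b
    rw [h, Vertex.scale]
  simp only [h]
  exact (π.surjective.exists (p := fun b => (f b).1 = i)).symm

end linePerms

end Hyperoctahedral

namespace BiTableau

open Hyperoctahedral

variable {n : ℕ} {lam mu : Bipartition n}

instance : Finite (BiTableau lam) :=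
  Finite.of_injective (fun t => (t.left, t.right)) fun _ _ h =>
    BiTableau.ext (Prod.mk.inj h).1 (Prod.mk.inj h).2

theorem left_injective (t : BiTableau lam) : Function.Injective fun b => (t.left b).1 :=
  t.injective.comp Sum.inl_injective

theorem right_injective (t : BiTableau lam) : Function.Injective fun b => (t.right b).1 :=
  t.injective.comp Sum.inr_injective

theorem left_ne_right (t : BiTableau lam) (b : lam.left.cells) (c : lam.right.cells) :
    (t.left b).1 ≠ (t.right c).1 := fun h => Sum.inl_ne_inr (t.injective h)

theorem exists_left_or_right (t : BiTableau lam) (i : Fin n) :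
    (∃ b, (t.left b).1 = i) ∨ ∃ b, (t.right b).1 = i := by
  have hbij := (Fintype.bijective_iff_injective_and_card _).2 ⟨t.injective, by
    rw [Fintype.card_sum, Fintype.card_coe, Fintype.card_coe, Fintype.card_fin]
    exact lam.card_add_card⟩
  obtain ⟨b | b, h⟩ := hbij.2 i
  · exact .inl ⟨b, h⟩
  · exact .inr ⟨b, h⟩

theorem signChange_mem_rowGroup (t : BiTableau lam) (b : lam.right.cells) :
    signChange (t.right b).1 ∈ t.rowGroup :=
  ⟨mem_linePerms_of_fixed fun c => signChange_apply_of_ne (t.left_ne_right c b),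
    mem_linePerms_top fun _ => signChange_apply_fst _ _⟩

theorem signChange_mem_colGroup (t : BiTableau lam) (b : lam.left.cells) :
    signChange (t.left b).1 ∈ t.colGroup :=
  ⟨mem_linePerms_top fun _ => signChange_apply_fst _ _,
    mem_linePerms_of_fixed fun c => signChange_apply_of_ne (t.left_ne_right b c).symm⟩

theorem signedSwap_left_mem_rowGroup (t : BiTableau lam) {p q : lam.left.cells} (hpq : p ≠ q)
    (hrow : p.1.1 = q.1.1) : signedSwap (t.left p) (t.left q) ∈ t.rowGroup := by
  refine Subgroup.mem_inf.2 ⟨?_, mem_linePerms_of_fixed fun c =>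
    signedSwap_of_ne (t.left_ne_right p c).symm (t.left_ne_right q c).symm⟩
  simpa only [Vertex.scale_one] using signedSwap_mem_linePerms t.left_injective hrow
    (Subgroup.one_mem ⊥) (Subgroup.one_mem ⊥) (t.left_injective.ne hpq)

theorem signedSwap_right_mem_rowGroup (t : BiTableau lam) {p q : lam.right.cells} (hpq : p ≠ q)
    (hrow : p.1.1 = q.1.1) (ε ε' : ℤˣ) :
    signedSwap ((t.right p).scale ε) ((t.right q).scale ε') ∈ t.rowGroup :=
  ⟨mem_linePerms_of_fixed fun c => signedSwap_of_ne (t.left_ne_right c p) (t.left_ne_right c q),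
    signedSwap_mem_linePerms t.right_injective hrow (Subgroup.mem_top _) (Subgroup.mem_top _)
      (t.right_injective.ne hpq)⟩

theorem signedSwap_left_mem_colGroup (t : BiTableau lam) {p q : lam.left.cells} (hpq : p ≠ q)
    (hcol : p.1.2 = q.1.2) (ε ε' : ℤˣ) :
    signedSwap ((t.left p).scale ε) ((t.left q).scale ε') ∈ t.colGroup :=
  ⟨signedSwap_mem_linePerms t.left_injective hcol (Subgroup.mem_top _) (Subgroup.mem_top _)
      (t.left_injective.ne hpq),
    mem_linePerms_of_fixed fun c =>
      signedSwap_of_ne (t.left_ne_right p c).symm (t.left_ne_right q c).symm⟩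

theorem signedSwap_right_mem_colGroup (t : BiTableau lam) {p q : lam.right.cells} (hpq : p ≠ q)
    (hcol : p.1.2 = q.1.2) : signedSwap (t.right p) (t.right q) ∈ t.colGroup := by
  refine Subgroup.mem_inf.2 ⟨mem_linePerms_of_fixed fun c =>
    signedSwap_of_ne (t.left_ne_right c p) (t.left_ne_right c q), ?_⟩
  simpa only [Vertex.scale_one] using signedSwap_mem_linePerms t.right_injective hcol
    (Subgroup.one_mem ⊥) (Subgroup.one_mem ⊥) (t.right_injective.ne hpq)

theorem exists_act_right_of_mem_rowGroup (t : BiTableau lam) {σ : Hyperoctahedral n}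
    (hσ : σ ∈ t.rowGroup) (i : Fin n) :
    (∃ b, ((t.act σ).right b).1 = i) ↔ ∃ b, (t.right b).1 = i :=
  exists_inv_apply_fst_eq_iff hσ.2 i

theorem exists_act_right_of_mem_colGroup (t : BiTableau lam) {σ : Hyperoctahedral n}
    (hσ : σ ∈ t.colGroup) (i : Fin n) :
    (∃ b, ((t.act σ).right b).1 = i) ↔ ∃ b, (t.right b).1 = i :=
  exists_inv_apply_fst_eq_iff hσ.2 i

theorem dominates_of_rowColumnDisjoint {s : BiTableau lam} {t : BiTableau mu}
    (hlr : ∀ b c, (s.left b).1 ≠ (t.right c).1) (hrl : ∀ b c, (s.right b).1 ≠ (t.left c).1)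
    (hleft : RowColumnDisjoint (fun b => (s.left b).1) fun c => (t.left c).1)
    (hright : RowColumnDisjoint (fun b => (s.right b).1) fun c => (t.right c).1) :
    mu.Dominates lam := by
  have left_subset : Set.range (fun b => (s.left b).1) ⊆ Set.range fun c => (t.left c).1 := by
    rintro _ ⟨b, rfl⟩
    exact (t.exists_left_or_right _).resolve_right fun ⟨c, hc⟩ => hlr b c hc.symm
  have right_subset : Set.range (fun b => (s.right b).1) ⊆ Set.range fun c => (t.right c).1 := by
    rintro _ ⟨b, rfl⟩
    exact (t.exists_left_or_right _).resolve_left fun ⟨c, hc⟩ => hrl b c hc.symm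
  have card_left : lam.left.card = mu.left.card := by
    obtain ⟨φ, hφ⟩ := Set.range_subset_range_iff_exists_comp.1 left_subset
    obtain ⟨ψ, hψ⟩ := Set.range_subset_range_iff_exists_comp.1 right_subset
    have hl : lam.left.card ≤ mu.left.card := by
      simpa using Fintype.card_le_of_injective φ (.of_comp (hφ ▸ s.left_injective))
    have hr : lam.right.card ≤ mu.right.card := by
      simpa using Fintype.card_le_of_injective ψ (.of_comp (hψ ▸ s.right_injective))
    have hlam := lam.card_add_card
    have hmu := mu.card_add_card
    omega
  exact ⟨sum_rowLen_le_of_rowColumnDisjoint s.left_injective left_subset hleft, fun j =>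
    card_left ▸ Nat.add_le_add_left
      (sum_rowLen_le_of_rowColumnDisjoint s.right_injective right_subset hright j) _⟩

section NoOddElement

variable {s : BiTableau lam} {t : BiTableau mu}

theorem right_ne_left_of_sgn_ne (h : ∀ σ ∈ s.rowGroup ⊓ t.colGroup, sgn σ ≠ -1)
    (b : lam.right.cells) (c : mu.left.cells) : (s.right b).1 ≠ (t.left c).1 := fun hbc =>
  h _ ⟨s.signChange_mem_rowGroup b, hbc ▸ t.signChange_mem_colGroup c⟩ (sgn_signChange _)

theorem rowColumnDisjoint_left_of_sgn_ne (h : ∀ σ ∈ s.rowGroup ⊓ t.colGroup, sgn σ ≠ -1) :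
    RowColumnDisjoint (fun b => (s.left b).1) fun c => (t.left c).1 := by
  intro p q p' q' hp hq hrow hcol
  by_contra hpq
  have hpq' : p' ≠ q' := by
    rintro rfl
    exact hpq (s.left_injective (hp.trans hq.symm))
  obtain ⟨ε, hε⟩ := Vertex.exists_eq_scale hp
  obtain ⟨ε', hε'⟩ := Vertex.exists_eq_scale hq
  refine h _ ⟨s.signedSwap_left_mem_rowGroup hpq hrow, ?_⟩
    (sgn_signedSwap (s.left_injective.ne hpq))
  rw [hε, hε']
  exact t.signedSwap_left_mem_colGroup hpq' hcol ε ε'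

theorem rowColumnDisjoint_right_of_sgn_ne (h : ∀ σ ∈ s.rowGroup ⊓ t.colGroup, sgn σ ≠ -1) :
    RowColumnDisjoint (fun b => (s.right b).1) fun c => (t.right c).1 := by
  intro p q p' q' hp hq hrow hcol
  by_contra hpq
  have hpq' : p' ≠ q' := by
    rintro rfl
    exact hpq (s.right_injective (hp.trans hq.symm))
  obtain ⟨ε, hε⟩ := Vertex.exists_eq_scale hp.symm
  obtain ⟨ε', hε'⟩ := Vertex.exists_eq_scale hq.symm
  refine h _ ⟨?_, t.signedSwap_right_mem_colGroup hpq' hcol⟩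
    (sgn_signedSwap (t.right_injective.ne hpq'))
  rw [hε, hε']
  exact s.signedSwap_right_mem_rowGroup hpq hrow ε ε'

end NoOddElement

end BiTableau

section SpechtHom

open Hyperoctahedral MulOpposite Representation

variable (K : Type*) [Field K] {n : ℕ} {lam mu : Bipartition n}

theorem BiTabloid.mk_act_of_mem_rowGroup (t : BiTableau lam) {σ : Hyperoctahedral n}
    (hσ : σ ∈ t.rowGroup) : mk (t.act σ) = mk t :=
  (Quotient.sound (⟨σ, hσ, rfl⟩ : (BiTableau.rowEquiv lam) t (t.act σ))).symm

theorem BiTabloid.exists_right_of_mk_eq {s t : BiTableau lam} (h : mk s = mk t) (i : Fin n) :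
    (∃ b, (t.right b).1 = i) ↔ ∃ b, (s.right b).1 = i := by
  obtain ⟨σ, hσ, rfl⟩ := Quotient.exact h
  exact s.exists_act_right_of_mem_rowGroup hσ i

theorem polytabloid_act_of_mem_colGroup (t : BiTableau lam) {τ : Hyperoctahedral n}
    (hτ : τ ∈ t.colGroup) : polytabloid K (t.act τ) = ((sgn τ : ℤ) : K) • polytabloid K t := by
  classical
  rw [polytabloid, polytabloid, Finset.smul_sum]
  refine Fintype.sum_equiv ((Equiv.mulLeft τ).subtypeEquiv fun σ => ?_) _ _ fun σ => ?_
  · rw [BiTableau.mem_colGroup_act]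
    exact t.colGroup.mul_mem_cancel_right (t.colGroup.inv_mem hτ)
  · rw [Finsupp.smul_single, ← BiTableau.act_mul]
    change Finsupp.single _ _ =
      Finsupp.single (BiTabloid.mk (t.act (τ * σ.1))) (_ * ((sgn (τ * σ.1) : ℤ) : K))
    rw [map_mul, ← Int.cast_mul, ← Units.val_mul, ← mul_assoc, Int.units_mul_self, one_mul]

theorem polytabloid_act_signChange_right (t : BiTableau lam) (b : lam.right.cells) :
    polytabloid K (t.act (signChange (t.right b).1)) = polytabloid K t := by
  classical
  rw [← permutationModule_polytabloid, polytabloid, map_sum]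
  refine Finset.sum_congr rfl fun σ _ => ?_
  obtain ⟨c, hc⟩ := (t.exists_act_right_of_mem_colGroup σ.2 (t.right b).1).2 ⟨b, rfl⟩
  rw [permutationModule_single, BiTabloid.op_smul_mk, ← hc,
    BiTabloid.mk_act_of_mem_rowGroup _ ((t.act σ.1).signChange_mem_rowGroup c)]

theorem polytabloid_apply_mk_eq_zero {s t : BiTableau lam} {b : lam.left.cells}
    {c : lam.right.cells} (h : (s.left b).1 = (t.right c).1) :
    polytabloid K t (BiTabloid.mk s) = 0 := by
  classical
  rw [polytabloid, Finsupp.finsetSum_apply]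
  refine Finset.sum_eq_zero fun σ _ => Finsupp.single_eq_of_ne fun hs => ?_
  obtain ⟨d, hd⟩ := (BiTabloid.exists_right_of_mk_eq hs _).1
    ((t.exists_act_right_of_mem_colGroup σ.2 (t.right c).1).2 ⟨c, rfl⟩)
  exact s.left_ne_right b d (h.trans hd.symm)

/-- A polytabloid as an element of the Specht module. -/
noncomputable def spechtPolytabloid (t : BiTableau lam) :
    (spechtSubrepresentation K lam).toSubmodule :=
  ⟨polytabloid K t, Submodule.subset_span ⟨t, rfl⟩⟩

/-- The coefficient of a bitabloid, as an element of the dual Specht module. -/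
noncomputable def coefficient (x : BiTabloid lam) :
    Module.Dual K (spechtSubrepresentation K lam).toSubmodule :=
  Finsupp.lapply x ∘ₗ Submodule.subtype _

theorem coefficient_spechtPolytabloid (x : BiTabloid lam) (t : BiTableau lam) :
    coefficient K x (spechtPolytabloid K t) = polytabloid K t x := rfl

variable {K} in
theorem dualSpecht_ext {φ ψ : Module.Dual K (spechtSubrepresentation K lam).toSubmodule}
    (h : ∀ t, φ (spechtPolytabloid K t) = ψ (spechtPolytabloid K t)) : φ = ψ := by
  refine LinearMap.ext_on (Submodule.span_span_coe_preimage (s := Set.range (polytabloid K))) ?_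
  rintro ⟨_, _⟩ ⟨t, rfl⟩
  exact h t

theorem span_range_coefficient :
    Submodule.span K (Set.range (coefficient K (lam := lam))) = ⊤ := by
  classical
  have : Finite (BiTabloid lam) := inferInstanceAs (Finite (Quotient _))
  have hcoeff : coefficient K (lam := lam) =
      (spechtSubrepresentation K lam).toSubmodule.dualRestrict ∘
        (Finsupp.basisSingleOne (R := K)).dualBasis := by
    funext x
    refine LinearMap.ext fun v => ?_
    simp [coefficient]
  rw [hcoeff, Set.range_comp, Submodule.span_image, Module.Basis.span_eq, Submodule.map_top,
    LinearMap.range_eq_top]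
  exact Subspace.dualRestrict_surjective

theorem dualSpechtModule_apply_spechtPolytabloid
    (φ : Module.Dual K (spechtSubrepresentation K lam).toSubmodule)
    (σ : Hyperoctahedral n) (t : BiTableau lam) :
    dualSpechtModule K lam (op σ) φ (spechtPolytabloid K (t.act σ)) =
      φ (spechtPolytabloid K t) := by
  change φ (spechtModule K lam (op σ)⁻¹ (spechtPolytabloid K (t.act σ))) = _
  congr 1
  apply Subtype.ext
  change permutationModule K lam (op σ)⁻¹ (polytabloid K (t.act σ)) = polytabloid K t
  rw [← op_inv, permutationModule_polytabloid, ← BiTableau.act_mul, mul_inv_cancel,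
    BiTableau.act_one]

theorem dualSpechtModule_coefficient (x : BiTabloid lam) (σ : (Hyperoctahedral n)ᵐᵒᵖ) :
    dualSpechtModule K lam σ (coefficient K x) = coefficient K (σ • x) := by
  refine LinearMap.ext fun v => ?_
  change permutationModule K lam σ⁻¹ v.1 x = v.1 (σ • x)
  have h := Finsupp.mapDomain_apply (M := K) (MulAction.injective σ⁻¹) v.1 (σ • x)
  rwa [inv_smul_smul] at h

theorem coefficient_mk_act_signChange_left (s : BiTableau lam) (b : lam.left.cells) :
    coefficient K (BiTabloid.mk (s.act (signChange (s.left b).1))) =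
      -coefficient K (BiTabloid.mk s) := by
  refine dualSpecht_ext fun t => ?_
  set c := signChange (s.left b).1 with hc
  obtain ⟨t, rfl⟩ : ∃ t', t = BiTableau.act t' c :=
    ⟨t.act c⁻¹, by rw [← BiTableau.act_mul, inv_mul_cancel, BiTableau.act_one]⟩
  rw [← BiTabloid.op_smul_mk, ← dualSpechtModule_coefficient,
    dualSpechtModule_apply_spechtPolytabloid, LinearMap.neg_apply, coefficient_spechtPolytabloid,
    coefficient_spechtPolytabloid]
  rcases t.exists_left_or_right (s.left b).1 with ⟨d, hd⟩ | ⟨d, hd⟩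
  · have hmem : c ∈ t.colGroup := hc ▸ hd ▸ t.signChange_mem_colGroup d
    rw [polytabloid_act_of_mem_colGroup K t hmem, hc, sgn_signChange]
    simp
  · rw [hc, ← hd, polytabloid_act_signChange_right, polytabloid_apply_mk_eq_zero K hd.symm,
      neg_zero]

theorem spechtPolytabloid_act_of_sgn_eq_neg_one {t : BiTableau lam} {σ : Hyperoctahedral n}
    (hσ : σ ∈ t.colGroup) (h : sgn σ = -1) :
    spechtPolytabloid K (t.act σ) = -spechtPolytabloid K t :=
  Subtype.ext ((polytabloid_act_of_mem_colGroup K t hσ).trans (by simp [h, spechtPolytabloid]))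

variable {K} (F : IntertwiningMap (dualSpechtModule K lam) (dualSpechtModule K mu))

theorem apply_coefficient_act (s : BiTableau lam) (t : BiTableau mu) (σ : Hyperoctahedral n) :
    F (coefficient K (BiTabloid.mk (s.act σ))) (spechtPolytabloid K (t.act σ)) =
      F (coefficient K (BiTabloid.mk s)) (spechtPolytabloid K t) := by
  rw [← BiTabloid.op_smul_mk, ← dualSpechtModule_coefficient, F.isIntertwining,
    dualSpechtModule_apply_spechtPolytabloid]

variable {F} {s : BiTableau lam} {t : BiTableau mu}

theorem sgn_ne_neg_one_of_apply_coefficient_ne_zero (hK : ringChar K ≠ 2)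
    (hF : F (coefficient K (BiTabloid.mk s)) (spechtPolytabloid K t) ≠ 0)
    {σ : Hyperoctahedral n} (hσ : σ ∈ s.rowGroup ⊓ t.colGroup) : sgn σ ≠ -1 := by
  intro hsgn
  have h := apply_coefficient_act F s t σ
  rw [BiTabloid.mk_act_of_mem_rowGroup s hσ.1, spechtPolytabloid_act_of_sgn_eq_neg_one K hσ.2 hsgn]
    at h
  have hneg := LinearMap.map_neg (F (coefficient K (BiTabloid.mk s))) (spechtPolytabloid K t)
  exact hF ((Ring.eq_self_iff_eq_zero_of_char_ne_two hK).1 (hneg.symm.trans h))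

theorem left_ne_right_of_apply_coefficient_ne_zero (hK : ringChar K ≠ 2)
    (hF : F (coefficient K (BiTabloid.mk s)) (spechtPolytabloid K t) ≠ 0)
    (b : lam.left.cells) (c : mu.right.cells) : (s.left b).1 ≠ (t.right c).1 := by
  intro hbc
  have ht : spechtPolytabloid K (t.act (signChange (s.left b).1)) = spechtPolytabloid K t := by
    rw [hbc]
    exact Subtype.ext (polytabloid_act_signChange_right K t c)
  have h := apply_coefficient_act F s t (signChange (s.left b).1)
  rw [coefficient_mk_act_signChange_left, ht, map_neg, LinearMap.neg_apply] at h
  exact hF ((Ring.eq_self_iff_eq_zero_of_char_ne_two hK).1 h)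

theorem dominates_of_intertwiningMap_ne_zero (hK : ringChar K ≠ 2) (hF : F ≠ 0) :
    mu.Dominates lam := by
  contrapose! hF
  refine IntertwiningMap.ext (LinearMap.ext_on_range (span_range_coefficient K) fun x =>
    dualSpecht_ext fun t => ?_)
  induction x using Quotient.ind with | _ s
  by_contra hst
  have hsgn : ∀ σ ∈ s.rowGroup ⊓ t.colGroup, sgn σ ≠ -1 := fun σ =>
    sgn_ne_neg_one_of_apply_coefficient_ne_zero hK hst
  exact hF (BiTableau.dominates_of_rowColumnDisjoint
    (left_ne_right_of_apply_coefficient_ne_zero hK hst) (BiTableau.right_ne_left_of_sgn_ne hsgn)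
    (BiTableau.rowColumnDisjoint_left_of_sgn_ne hsgn)
    (BiTableau.rowColumnDisjoint_right_of_sgn_ne hsgn))

end SpechtHom

namespace BrauerDiagram

variable {V : Type*}

theorem partner_injective (d : BrauerDiagram V) : Function.Injective d.partner :=
  Function.LeftInverse.injective d.partner_partner

theorem partner_eq_comm (d : BrauerDiagram V) {x y : V ⊕ V} (h : d.partner x = y) :
    d.partner y = x := by
  rw [← h, d.partner_partner]

section Comp

variable [Finite V] {d e : BrauerDiagram V} {u v w : V}

theorem comp_partner_inl (h : d.partner (.inl v) = .inl w) :
    (d.comp e).partner (.inl v) = .inl w := by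
  rw [comp_partner_eq_iff]
  refine ⟨h ▸ d.partner_ne _, ?_⟩
  have top := stack_up d e (.inl v)
  rwa [h] at top

theorem comp_partner_inr (h : e.partner (.inr v) = .inr w) :
    (d.comp e).partner (.inr v) = .inr w := by
  rw [comp_partner_eq_iff]
  refine ⟨h ▸ e.partner_ne _, ?_⟩
  have bottom := stack_inr d e (.inr v)
  rwa [h] at bottom

theorem comp_partner_inl_inr (h : d.partner (.inl u) = .inr v)
    (h' : e.partner (.inl v) = .inr w) : (d.comp e).partner (.inl u) = .inr w := by
  rw [comp_partner_eq_iff]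
  have top := stack_up d e (.inl u)
  have bottom := stack_inr d e (.inl v)
  rw [h] at top
  rw [h'] at bottom
  exact ⟨Sum.inr_ne_inl, (stack d e).trans top bottom⟩

end Comp

theorem not_exists_partner_eq_inl {d : BrauerDiagram V} {x : V ⊕ V} :
    (¬∃ w, d.partner x = .inl w) ↔ ∃ w, d.partner x = .inr w := by
  cases d.partner x <;> simp

theorem not_exists_partner_eq_inr {d : BrauerDiagram V} {x : V ⊕ V} :
    (¬∃ w, d.partner x = .inr w) ↔ ∃ w, d.partner x = .inl w := by
  cases d.partner x <;> simp

open scoped Classical in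
theorem card_vertical_inl_eq_inr [Fintype V] (d : BrauerDiagram V) :
    (Finset.univ.filter fun v => ∃ w, d.partner (.inl v) = .inr w).card =
      (Finset.univ.filter fun v => ∃ w, d.partner (.inr v) = .inl w).card := by
  refine Finset.card_nbij' (fun v => Sum.elim id id (d.partner (.inl v)))
    (fun v => Sum.elim id id (d.partner (.inr v))) ?_ ?_ ?_ ?_ <;> intro v hv <;>
    obtain ⟨w, hw⟩ := (Finset.mem_filter.1 hv).2 <;> simp [hw, d.partner_eq_comm hw]

theorem card_horizontal_inl_eq_inr [Fintype V] (d : BrauerDiagram V)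
    [DecidablePred fun v => ∃ w, d.partner (.inl v) = .inl w]
    [DecidablePred fun v => ∃ w, d.partner (.inr v) = .inr w] :
    (Finset.univ.filter fun v => ∃ w, d.partner (.inl v) = .inl w).card =
      (Finset.univ.filter fun v => ∃ w, d.partner (.inr v) = .inr w).card := by
  classical
  have top := Finset.card_filter_add_card_filter_not (s := Finset.univ)
    fun v => ∃ w, d.partner (.inl v) = .inl w
  have bottom := Finset.card_filter_add_card_filter_not (s := Finset.univ)
    fun v => ∃ w, d.partner (.inr v) = .inr w
  simp only [not_exists_partner_eq_inl] at top
  simp only [not_exists_partner_eq_inr] at bottom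
  have vertical := d.card_vertical_inl_eq_inr
  omega

end BrauerDiagram

theorem Hyperoctahedral.extend_shift {r l : ℕ} (σ : Hyperoctahedral (r - l))
    (y : Vertex (r - l)) :
    (extend r l σ).1 (Vertex.shift r l y) = Vertex.shift r l (σ.1 y) :=
  Equiv.Perm.viaEmbedding_apply _ _ _

theorem Vertex.le_shift_fst {r l : ℕ} (y : Vertex (r - l)) : l ≤ (shift r l y).1.1 :=
  Nat.le_add_left _ _

namespace DiagramC

variable {r l : ℕ}

theorem numArcs_le_mul_right (d e : DiagramC r) : numArcs d ≤ numArcs (d * e) := by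
  refine Nat.div_le_div_right (Finset.card_le_card fun v hv => ?_)
  obtain ⟨w, hw⟩ := (Finset.mem_filter.1 hv).2
  exact Finset.mem_filter.2 ⟨Finset.mem_univ _, w, BrauerDiagram.comp_partner_inl hw⟩

open scoped Classical in
theorem numArcs_eq_card_inr (d : DiagramC r) : numArcs d =
    (Finset.univ.filter fun v : Vertex r => ∃ w, d.1.partner (.inr v) = .inr w).card / 2 :=
  congrArg (· / 2) d.1.card_horizontal_inl_eq_inr

theorem numArcs_le_mul_left (d e : DiagramC r) : numArcs e ≤ numArcs (d * e) := by
  rw [numArcs_eq_card_inr, numArcs_eq_card_inr]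
  refine Nat.div_le_div_right (Finset.card_le_card fun v hv => ?_)
  obtain ⟨w, hw⟩ := (Finset.mem_filter.1 hv).2
  exact Finset.mem_filter.2 ⟨Finset.mem_univ _, w, BrauerDiagram.comp_partner_inr hw⟩

theorem numArcs_mul_ofPerm (d : DiagramC r) (σ : Hyperoctahedral r) :
    numArcs (d * ofPerm σ) = numArcs d := by
  refine le_antisymm ?_ (numArcs_le_mul_right _ _)
  calc numArcs (d * ofPerm σ) ≤ numArcs (d * ofPerm σ * ofPerm σ⁻¹) := numArcs_le_mul_right _ _
    _ = numArcs d := by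
      rw [mul_assoc, ofPerm_mul, mul_inv_cancel]
      exact congrArg numArcs (mul_one d)

/-- The diagram `d` has the horizontal edges `{-i, i}`, for `1 ≤ i ≤ l`, in both rows, as `arcs r l`
does. -/
def HasArcs (l : ℕ) (d : DiagramC r) : Prop :=
  ∀ v : Vertex r, v.1.1 < l →
    d.1.partner (.inl v) = .inl v.neg ∧ d.1.partner (.inr v) = .inr v.neg

theorem hasArcs_arcs (r l : ℕ) : HasArcs l (arcs r l) := fun _ h => ⟨if_pos h, if_pos h⟩

theorem arcs_partner_inl_of_le {v : Vertex r} (h : l ≤ v.1.1) :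
    (arcs r l).1.partner (.inl v) = .inr v := if_neg h.not_gt

theorem HasArcs.mul {d e : DiagramC r} (hd : HasArcs l d) (he : HasArcs l e) :
    HasArcs l (d * e) := fun v hv =>
  ⟨BrauerDiagram.comp_partner_inl (hd v hv).1, BrauerDiagram.comp_partner_inr (he v hv).2⟩

theorem hasArcs_arcs_mul_mul_arcs (l : ℕ) (d : DiagramC r) :
    HasArcs l (arcs r l * d * arcs r l) := fun v hv =>
  ⟨BrauerDiagram.comp_partner_inl (BrauerDiagram.comp_partner_inl (hasArcs_arcs r l v hv).1),
    BrauerDiagram.comp_partner_inr (hasArcs_arcs r l v hv).2⟩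

theorem hasArcs_arcs_mul_ofPerm (σ : Hyperoctahedral (r - l)) :
    HasArcs l (arcs r l * ofPerm (Hyperoctahedral.extend r l σ)) := by
  intro v hv
  refine ⟨BrauerDiagram.comp_partner_inl (hasArcs_arcs r l v hv).1, ?_⟩
  rw [← ofPerm_mul_arcs]
  exact BrauerDiagram.comp_partner_inr (hasArcs_arcs r l v hv).2

theorem HasArcs.ext {d e : DiagramC r} (hd : HasArcs l d) (he : HasArcs l e)
    (h : ∀ y : Vertex (r - l), ∃ z : Vertex (r - l),
      d.1.partner (.inl (Vertex.shift r l z)) = .inr (Vertex.shift r l y) ∧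
        e.1.partner (.inl (Vertex.shift r l z)) = .inr (Vertex.shift r l y)) : d = e := by
  choose f hdf hef using h
  have hf : Function.Surjective f := Finite.surjective_of_injective fun y y' hy =>
    (Vertex.shift r l).injective (Sum.inr_injective ((hdf y).symm.trans (hy ▸ hdf y')))
  refine Subtype.ext (BrauerDiagram.ext (funext fun x => ?_))
  rcases x with v | v <;> rcases lt_or_ge v.1.1 l with hv | hv
  · rw [(hd v hv).1, (he v hv).1]
  · obtain ⟨z, rfl⟩ := (Vertex.mem_range_shift v).2 hv
    obtain ⟨y, rfl⟩ := hf z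
    rw [hdf, hef]
  · rw [(hd v hv).2, (he v hv).2]
  · obtain ⟨y, rfl⟩ := (Vertex.mem_range_shift v).2 hv
    rw [d.1.partner_eq_comm (hdf y), e.1.partner_eq_comm (hef y)]

theorem arcs_mul_arcs (l : ℕ) : arcs r l * arcs r l = arcs r l := by
  refine HasArcs.ext ((hasArcs_arcs r l).mul (hasArcs_arcs r l)) (hasArcs_arcs r l) fun y => ?_
  have h := arcs_partner_inl_of_le y.le_shift_fst
  exact ⟨y, BrauerDiagram.comp_partner_inl_inr h h, h⟩

theorem arcs_mul_ofPerm_partner_inl_shift (σ : Hyperoctahedral (r - l)) (y : Vertex (r - l)) :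
    (arcs r l * ofPerm (Hyperoctahedral.extend r l σ)).1.partner
      (.inl (Vertex.shift r l (σ.1 y))) = .inr (Vertex.shift r l y) := by
  refine BrauerDiagram.comp_partner_inl_inr (arcs_partner_inl_of_le (Vertex.le_shift_fst _)) ?_
  rw [← Hyperoctahedral.extend_shift]
  exact congrArg Sum.inr (Equiv.symm_apply_apply _ _)

theorem arcs_mul_ofPerm_injective (l : ℕ) :
    Function.Injective fun σ : Hyperoctahedral (r - l) =>
      arcs r l * ofPerm (Hyperoctahedral.extend r l σ) := by
  intro σ τ (h : arcs r l * ofPerm _ = arcs r l * ofPerm _)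
  refine Subtype.ext (Equiv.ext fun y => ?_)
  have hσ := arcs_mul_ofPerm_partner_inl_shift σ y
  rw [h, ← arcs_mul_ofPerm_partner_inl_shift τ y] at hσ
  exact (Vertex.shift r l).injective (Sum.inl_injective (BrauerDiagram.partner_injective _ hσ))

theorem card_filter_fst_lt_eq (hl : l ≤ r) :
    (Finset.univ.filter fun v : Vertex r => v.1.1 < l).card = 2 * l := by
  have h : (Finset.univ.filter fun v : Vertex r => v.1.1 < l) =
      (Finset.univ.filter fun i : Fin r => i.1 < l) ×ˢ Finset.univ := by
    ext v
    simp only [Finset.mem_filter, Finset.mem_univ, true_and, Finset.mem_product, and_true]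
  rw [h, Finset.card_product, Fin.card_filter_val_lt, min_eq_right hl]
  simp [mul_comm]

theorem numArcs_arcs (hl : l ≤ r) : numArcs (arcs r l) = l := by
  have h : ∀ v : Vertex r, (∃ w, (arcs r l).1.partner (.inl v) = .inl w) ↔ v.1.1 < l := by
    refine fun v => ⟨?_, fun h => ⟨_, (hasArcs_arcs r l v h).1⟩⟩
    rintro ⟨w, hw⟩
    by_contra h
    rw [arcs_partner_inl_of_le (not_lt.1 h)] at hw
    exact Sum.inr_ne_inl hw
  have hcard := card_filter_fst_lt_eq hl
  simp only [← h] at hcard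
  rw [numArcs]
  convert congrArg (· / 2) hcard using 2
  omega

theorem HasArcs.le_fst_of_partner_inl {d : DiagramC r} (h : HasArcs l d) {v w : Vertex r}
    (hv : l ≤ v.1.1) (hw : d.1.partner (.inl v) = .inl w ∨ d.1.partner (.inl v) = .inr w) :
    l ≤ w.1.1 := by
  by_contra! hwl
  obtain hw | hw := hw <;> have hw' := d.1.partner_eq_comm hw
  · rw [(h w hwl).1] at hw'
    obtain rfl := Sum.inl_injective hw'
    exact hv.not_gt hwl
  · rw [(h w hwl).2] at hw'
    exact Sum.inr_ne_inl hw'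

theorem HasArcs.exists_partner_inl_eq_inr {d : DiagramC r} (h : HasArcs l d) (hl : l ≤ r)
    (hd : numArcs d ≤ l) {v : Vertex r} (hv : l ≤ v.1.1) :
    ∃ w : Vertex r, l ≤ w.1.1 ∧ d.1.partner (.inl v) = .inr w := by
  classical
  rcases hw : d.1.partner (.inl v) with w | w
  · have hvw : v ≠ w := fun hvw => d.1.partner_ne (.inl v) (hw.trans (by rw [hvw]))
    have hsub : insert v (insert w (Finset.univ.filter fun v : Vertex r => v.1.1 < l)) ⊆
        Finset.univ.filter fun v : Vertex r => ∃ w, d.1.partner (.inl v) = .inl w := by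
      simp only [Finset.insert_subset_iff, Finset.mem_filter, Finset.mem_univ, true_and]
      exact ⟨⟨w, hw⟩, ⟨v, d.1.partner_eq_comm hw⟩, fun x hx =>
        Finset.mem_filter.2 ⟨Finset.mem_univ _, _, (h x (Finset.mem_filter.1 hx).2).1⟩⟩
    have hcard := Finset.card_le_card hsub
    rw [Finset.card_insert_of_notMem (by simpa [hvw] using hv),
      Finset.card_insert_of_notMem (by simpa using h.le_fst_of_partner_inl hv (.inl hw)),
      card_filter_fst_lt_eq hl] at hcard
    have hlt : l < numArcs d := by
      rw [numArcs, Nat.lt_iff_add_one_le, Nat.le_div_iff_mul_le two_pos]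
      convert hcard using 1
      omega
    exact absurd hd hlt.not_ge
  · exact ⟨w, h.le_fst_of_partner_inl hv (.inr hw), rfl⟩

theorem HasArcs.exists_perm {d : DiagramC r} (h : HasArcs l d) (hl : l ≤ r) (hd : numArcs d ≤ l) :
    ∃ σ : Hyperoctahedral (r - l), ∀ y,
      d.1.partner (.inl (Vertex.shift r l (σ.1 y))) = .inr (Vertex.shift r l y) := by
  have hshift : ∀ y : Vertex (r - l), ∃ z,
      d.1.partner (.inl (Vertex.shift r l y)) = .inr (Vertex.shift r l z) := by
    intro y
    obtain ⟨w, hwl, hw⟩ := h.exists_partner_inl_eq_inr hl hd y.le_shift_fst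
    obtain ⟨z, rfl⟩ := (Vertex.mem_range_shift w).2 hwl
    exact ⟨z, hw⟩
  choose τ hτ using hshift
  have τ_injective : Function.Injective τ := fun y z hyz =>
    (Vertex.shift r l).injective (Sum.inl_injective (d.1.partner_injective
      ((hτ y).trans (hyz ▸ (hτ z).symm))))
  have τ_neg : ∀ y, τ y.neg = (τ y).neg := fun y => by
    have hy := d.2 (.inl (Vertex.shift r l y))
    rw [hτ] at hy
    exact (Vertex.shift r l).injective (Sum.inr_injective ((hτ y.neg).symm.trans hy))
  let ρ : Hyperoctahedral (r - l) :=
    ⟨Equiv.ofBijective τ (Finite.injective_iff_bijective.1 τ_injective), τ_neg⟩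
  refine ⟨ρ⁻¹, fun y => ?_⟩
  rw [hτ, show τ ((ρ⁻¹).1 y) = y from ρ.1.apply_symm_apply y]

theorem HasArcs.exists_eq_arcs_mul_ofPerm {d : DiagramC r} (h : HasArcs l d) (hl : l ≤ r)
    (hd : numArcs d ≤ l) :
    ∃ σ : Hyperoctahedral (r - l), d = arcs r l * ofPerm (Hyperoctahedral.extend r l σ) := by
  obtain ⟨σ, hσ⟩ := h.exists_perm hl hd
  exact ⟨σ, h.ext (hasArcs_arcs_mul_ofPerm σ) fun y =>
    ⟨σ.1 y, hσ y, arcs_mul_ofPerm_partner_inl_shift σ y⟩⟩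

theorem numArcs_or_exists_arcs_mul_mul_arcs_eq (hl : l ≤ r) (d : DiagramC r) :
    l + 1 ≤ numArcs (arcs r l * d * arcs r l) ∨ ∃ σ : Hyperoctahedral (r - l),
      arcs r l * d * arcs r l = arcs r l * ofPerm (Hyperoctahedral.extend r l σ) :=
  (lt_or_ge l _).imp_right ((hasArcs_arcs_mul_mul_arcs l d).exists_eq_arcs_mul_ofPerm hl)

end DiagramC

namespace BrauerC

open MulOpposite
open scoped TensorProduct

variable {K : Type*} [Field K] {r : ℕ} {δ : K}

section Ideal

variable {l : ℕ}

theorem basis_mem_J {d : DiagramC r} (h : l ≤ d.numArcs) : basis δ d ∈ J K r δ l :=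
  TwoSidedIdeal.subset_span ⟨d, h, rfl⟩

theorem smul_mem_J (a : K) {x : BrauerC K r δ} (hx : x ∈ J K r δ l) : a • x ∈ J K r δ l := by
  rw [← smul_one_mul]
  exact (J K r δ l).mul_mem_left _ _ hx

variable (K r δ l) in
/-- The span of the diagrams with at least `l` horizontal edges, which is the underlying space of
the ideal `J_l`. -/
noncomputable def arcSpan : Submodule K (BrauerC K r δ) :=
  Submodule.span K {x | ∃ d : DiagramC r, l ≤ d.numArcs ∧ x = basis δ d}

theorem mul_mem_arcSpan_right (x : BrauerC K r δ) {y : BrauerC K r δ}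
    (hy : y ∈ arcSpan K r δ l) : x * y ∈ arcSpan K r δ l := by
  have h : ⊤ * arcSpan K r δ l ≤ arcSpan K r δ l := by
    rw [← (basis δ).span_eq, arcSpan, Submodule.span_mul_span, Submodule.span_le]
    rintro _ ⟨_, ⟨d, rfl⟩, _, ⟨e, he, rfl⟩, rfl⟩
    simp only [basis_mul_basis]
    exact Submodule.smul_mem _ _
      (Submodule.subset_span ⟨d * e, he.trans (d.numArcs_le_mul_left e), rfl⟩)
  exact h (Submodule.mul_mem_mul Submodule.mem_top hy)

theorem mul_mem_arcSpan_left {x : BrauerC K r δ} (hx : x ∈ arcSpan K r δ l)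
    (y : BrauerC K r δ) : x * y ∈ arcSpan K r δ l := by
  have h : arcSpan K r δ l * ⊤ ≤ arcSpan K r δ l := by
    rw [← (basis δ).span_eq, arcSpan, Submodule.span_mul_span, Submodule.span_le]
    rintro _ ⟨_, ⟨d, hd, rfl⟩, _, ⟨e, rfl⟩, rfl⟩
    simp only [basis_mul_basis]
    exact Submodule.smul_mem _ _
      (Submodule.subset_span ⟨d * e, hd.trans (d.numArcs_le_mul_right e), rfl⟩)
  exact h (Submodule.mul_mem_mul hx Submodule.mem_top)

theorem mem_arcSpan_of_mem_J {x : BrauerC K r δ} (hx : x ∈ J K r δ l) :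
    x ∈ arcSpan K r δ l := by
  let I : TwoSidedIdeal (BrauerC K r δ) := TwoSidedIdeal.mk' (arcSpan K r δ l)
    (Submodule.zero_mem _) (Submodule.add_mem _) (Submodule.neg_mem _)
    (mul_mem_arcSpan_right _) (mul_mem_arcSpan_left · _)
  have hI : J K r δ l ≤ I := TwoSidedIdeal.span_le.2 fun x hx =>
    (TwoSidedIdeal.mem_mk' _ _ _ _ _ _ _).2 (Submodule.subset_span hx)
  exact (TwoSidedIdeal.mem_mk' _ _ _ _ _ _ _).1 (hI hx)

theorem coord_eq_zero_of_mem_J {x : BrauerC K r δ} (hx : x ∈ J K r δ l) {d : DiagramC r}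
    (hd : d.numArcs < l) : (basis δ).coord d x = 0 := by
  have h : arcSpan K r δ l ≤ LinearMap.ker ((basis δ).coord d) := by
    refine Submodule.span_le.2 ?_
    rintro _ ⟨e, he, rfl⟩
    rw [SetLike.mem_coe, LinearMap.mem_ker, Module.Basis.coord_apply, Module.Basis.repr_self]
    exact Finsupp.single_eq_of_ne (by rintro rfl; omega)
  exact h (mem_arcSpan_of_mem_J hx)

end Ideal

theorem coord_ofPerm_mul (σ : Hyperoctahedral r) (d : DiagramC r) (x : BrauerC K r δ) :
    (basis δ).coord d (basis δ (DiagramC.ofPerm σ) * x) =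
      (basis δ).coord (DiagramC.ofPerm σ⁻¹ * d) x := by
  classical
  suffices h : (basis δ).coord d ∘ₗ LinearMap.mulLeft K (basis δ (DiagramC.ofPerm σ)) =
      (basis δ).coord (DiagramC.ofPerm σ⁻¹ * d) from LinearMap.congr_fun h x
  refine (basis δ).ext fun e => ?_
  have hiff : DiagramC.ofPerm σ * e = d ↔ e = DiagramC.ofPerm σ⁻¹ * d := by
    constructor <;> rintro rfl
    · rw [← mul_assoc, DiagramC.ofPerm_mul, inv_mul_cancel]
      exact (one_mul e).symm
    · rw [← mul_assoc, DiagramC.ofPerm_mul, mul_inv_cancel]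
      exact one_mul d
  rw [LinearMap.comp_apply, LinearMap.mulLeft_apply, basis_mul_basis, DiagramC.loops_ofPerm_left,
    pow_zero, one_smul, Module.Basis.coord_apply, Module.Basis.repr_self, Module.Basis.coord_apply,
    Module.Basis.repr_self, Finsupp.single_apply, Finsupp.single_apply]
  exact if_congr hiff rfl rfl

theorem exists_idem_mul_smul_arcs_eq_idem (hδ : δ ≠ 0) (l : ℕ) :
    ∃ a : K, idem K r δ l * (a • basis δ (DiagramC.arcs r l)) = idem K r δ l := by
  refine ⟨(δ ^ (DiagramC.arcs r l).loops (DiagramC.arcs r l))⁻¹, ?_⟩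
  rw [idem, mul_smul_comm, smul_mul_assoc, basis_mul_basis, DiagramC.arcs_mul_arcs,
    smul_comm, inv_smul_smul₀ (pow_ne_zero _ hδ)]

section Layer

variable {l : ℕ}

variable (K r δ l) in
/-- The map `x ↦ e_l x` from `B` onto `e_l (B / J_{l+1})`. -/
noncomputable def toLayer : BrauerC K r δ →ₗ[(BrauerC K r δ)ᵐᵒᵖ] Layer K r δ l :=
  (leftMul K r δ (l + 1) (idem K r δ l)).rangeRestrict ∘ₗ (rightJ K r δ (l + 1)).mkQ

theorem toLayer_surjective : Function.Surjective (toLayer K r δ l) :=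
  (LinearMap.surjective_rangeRestrict _).comp (Submodule.mkQ_surjective _)

theorem op_smul_toLayer (x y : BrauerC K r δ) :
    op y • toLayer K r δ l x = toLayer K r δ l (x * y) :=
  ((toLayer K r δ l).map_smul (op y) x).symm

theorem op_smul_toLayer_one (x : BrauerC K r δ) :
    op x • toLayer K r δ l 1 = toLayer K r δ l x := by
  rw [op_smul_toLayer, one_mul]

theorem toLayer_smul (a : K) (x : BrauerC K r δ) :
    toLayer K r δ l (a • x) = a • toLayer K r δ l x :=
  ((toLayer K r δ l).restrictScalars K).map_smul a x

theorem toLayer_eq_of_idem_mul_eq {x y : BrauerC K r δ}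
    (h : idem K r δ l * x = idem K r δ l * y) : toLayer K r δ l x = toLayer K r δ l y :=
  Subtype.ext (congrArg (Submodule.Quotient.mk (p := rightJ K r δ (l + 1))) h)

theorem toLayer_eq_zero_of_idem_mul_mem_J {x : BrauerC K r δ}
    (h : idem K r δ l * x ∈ J K r δ (l + 1)) : toLayer K r δ l x = 0 :=
  Subtype.ext ((Submodule.Quotient.mk_eq_zero (rightJ K r δ (l + 1))).2 h)

theorem layerAct_toLayer (σ : Hyperoctahedral (r - l)) (x : BrauerC K r δ) :
    layerAct K r δ l σ (toLayer K r δ l x) =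
      toLayer K r δ l (ofHyperoctahedral K r δ l σ * x) := by
  refine Subtype.ext (congrArg (Submodule.Quotient.mk (p := rightJ K r δ (l + 1))) ?_)
  change ofHyperoctahedral K r δ l σ * (idem K r δ l * x) =
    idem K r δ l * (ofHyperoctahedral K r δ l σ * x)
  rw [← mul_assoc, ← mul_assoc, ofHyperoctahedral_mul_idem]

theorem toLayer_basis_mul_arcs_mem_span (hl : l ≤ r) (d : DiagramC r) :
    toLayer K r δ l (basis δ d * basis δ (DiagramC.arcs r l)) ∈
      Submodule.span K
        (Set.range fun σ => toLayer K r δ l (ofHyperoctahedral K r δ l σ)) := by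
  obtain ⟨a, ha⟩ : ∃ a : K, basis δ (DiagramC.arcs r l) *
      (basis δ d * basis δ (DiagramC.arcs r l)) =
      a • basis δ (DiagramC.arcs r l * d * DiagramC.arcs r l) := by
    rw [← mul_assoc, basis_mul_basis, smul_mul_assoc, basis_mul_basis, smul_smul]
    exact ⟨_, rfl⟩
  rcases DiagramC.numArcs_or_exists_arcs_mul_mul_arcs_eq hl d with h | ⟨σ, hσ⟩
  · rw [toLayer_eq_zero_of_idem_mul_mem_J]
    · exact Submodule.zero_mem _
    · rw [idem, smul_mul_assoc, ha]
      exact smul_mem_J _ (smul_mem_J _ (basis_mem_J h))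
  · have h : idem K r δ l * (basis δ d * basis δ (DiagramC.arcs r l)) =
        idem K r δ l * (a • ofHyperoctahedral K r δ l σ) := by
      rw [idem, smul_mul_assoc, smul_mul_assoc, ha, hσ, mul_smul_comm, ofHyperoctahedral,
        basis_mul_basis, DiagramC.loops_ofPerm_right, pow_zero, one_smul]
    rw [toLayer_eq_of_idem_mul_eq h, toLayer_smul]
    exact Submodule.smul_mem _ _ (Submodule.subset_span ⟨σ, rfl⟩)

theorem toLayer_mul_arcs_mem_span (hl : l ≤ r) (b : BrauerC K r δ) :
    toLayer K r δ l (b * basis δ (DiagramC.arcs r l)) ∈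
      Submodule.span K
        (Set.range fun σ => toLayer K r δ l (ofHyperoctahedral K r δ l σ)) := by
  let mulArcs := (toLayer K r δ l).restrictScalars K ∘ₗ
    LinearMap.mulRight K (basis δ (DiagramC.arcs r l))
  have h : Submodule.span K (Set.range (basis (K := K) (r := r) δ)) ≤ (Submodule.span K
      (Set.range fun σ => toLayer K r δ l (ofHyperoctahedral K r δ l σ))).comap mulArcs :=
    Submodule.span_le.2 (Set.range_subset_iff.2 (toLayer_basis_mul_arcs_mem_span hl))
  exact h ((basis δ).mem_span b)

/-- The coefficient of `e_l σ` in an element of `e_l (B / J_{l+1})`; the factor `δ ^ l` is the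
inverse of the coefficient of the diagram `arcs r l` in `e_l`. -/
noncomputable def layerCoeff (δ : K) (hl : l ≤ r) (σ : Hyperoctahedral (r - l)) :
    Layer K r δ l →ₗ[K] K :=
  δ ^ l • ((rightJ K r δ (l + 1)).restrictScalars K).liftQ
      ((basis δ).coord (DiagramC.arcs r l * DiagramC.ofPerm (Hyperoctahedral.extend r l σ)))
      (fun _ hx => coord_eq_zero_of_mem_J hx (by
        rw [DiagramC.numArcs_mul_ofPerm, DiagramC.numArcs_arcs hl]
        exact lt_add_one l)) ∘ₗ
    (Submodule.Quotient.restrictScalarsEquiv K (rightJ K r δ (l + 1))).symm.toLinearMap ∘ₗ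
    (layerModule K r δ l).subtype.restrictScalars K

theorem layerCoeff_toLayer (hl : l ≤ r) (σ : Hyperoctahedral (r - l)) (x : BrauerC K r δ) :
    layerCoeff δ hl σ (toLayer K r δ l x) =
      δ ^ l * (basis δ).coord
        (DiagramC.arcs r l * DiagramC.ofPerm (Hyperoctahedral.extend r l σ))
        (idem K r δ l * x) := rfl

theorem layerCoeff_layerAct (hl : l ≤ r) (σ τ : Hyperoctahedral (r - l)) (x : Layer K r δ l) :
    layerCoeff δ hl τ (layerAct K r δ l σ x) = layerCoeff δ hl (σ⁻¹ * τ) x := by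
  obtain ⟨x, rfl⟩ := toLayer_surjective x
  rw [layerAct_toLayer, layerCoeff_toLayer, layerCoeff_toLayer, ← mul_assoc (idem K r δ l),
    ← ofHyperoctahedral_mul_idem, mul_assoc (ofHyperoctahedral K r δ l σ), ofHyperoctahedral,
    coord_ofPerm_mul, ← mul_assoc, ← map_inv, DiagramC.ofPerm_mul_arcs, mul_assoc,
    DiagramC.ofPerm_mul, ← (Hyperoctahedral.extend r l).map_mul]

theorem layerCoeff_toLayer_one (hδ : δ ≠ 0) (hl : l ≤ r) (σ : Hyperoctahedral (r - l))
    [Decidable (σ = 1)] :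
    layerCoeff δ hl σ (toLayer K r δ l 1) = if σ = 1 then 1 else 0 := by
  classical
  have h : DiagramC.arcs r l = DiagramC.arcs r l *
      DiagramC.ofPerm (Hyperoctahedral.extend r l σ) ↔ σ = 1 := by
    rw [← (DiagramC.arcs_mul_ofPerm_injective l).eq_iff, map_one,
      show DiagramC.ofPerm (1 : Hyperoctahedral r) = 1 from rfl, mul_one]
    exact eq_comm
  rw [layerCoeff_toLayer, mul_one, idem, map_smul, Module.Basis.coord_apply,
    Module.Basis.repr_self, Finsupp.single_apply, smul_eq_mul,
    mul_inv_cancel_left₀ (pow_ne_zero l hδ)]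
  exact if_congr h rfl rfl

end Layer

section Induction

variable {l : ℕ} {V : Type*} [AddCommGroup V] [Module K V]
  (ρ : Representation K (Hyperoctahedral (r - l))ᵐᵒᵖ V)

/-- The map `v ↦ v ⊗ e_l` from `V` to `ind_l V`. -/
noncomputable def toInd (δ : K) : V →ₗ[K] ind K δ l ρ :=
  (balanced K δ l ρ).mkQ.restrictScalars K ∘ₗ TensorProduct.mk K _ _ (toLayer K r δ l 1)

theorem op_smul_toInd (b : BrauerC K r δ) (v : V) :
    op b • toInd ρ δ v = Submodule.Quotient.mk (toLayer K r δ l b ⊗ₜ[K] v) :=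
  congrArg (fun x : Layer K r δ l => (Submodule.Quotient.mk (x ⊗ₜ[K] v) : ind K δ l ρ))
    (op_smul_toLayer_one b)

theorem toInd_act (v : V) (σ : Hyperoctahedral (r - l)) :
    toInd ρ δ (ρ (op σ) v) = op (ofHyperoctahedral K r δ l σ) • toInd ρ δ v := by
  rw [op_smul_toInd, ← mul_one (ofHyperoctahedral K r δ l σ), ← layerAct_toLayer]
  exact (Submodule.Quotient.eq _).2 (Submodule.subset_span ⟨toLayer K r δ l 1, v, σ, rfl⟩)

theorem op_smul_toInd_of_idem_mul_eq {b : BrauerC K r δ}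
    (hb : idem K r δ l * b = idem K r δ l) (v : V) : op b • toInd ρ δ v = toInd ρ δ v := by
  rw [op_smul_toInd, toLayer_eq_of_idem_mul_eq (hb.trans (mul_one _).symm)]
  rfl

variable {ρ} in
theorem ind_induction {p : ind K δ l ρ → Prop} (zero : p 0)
    (add : ∀ x y, p x → p y → p (x + y))
    (op_smul : ∀ (b : BrauerC K r δ) v, p (op b • toInd ρ δ v)) (z : ind K δ l ρ) : p z := by
  induction z using Submodule.Quotient.induction_on with | _ z
  induction z using TensorProduct.induction_on with
  | zero => exact zero
  | tmul x v =>
    obtain ⟨b, rfl⟩ := toLayer_surjective x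
    exact op_smul_toInd ρ b v ▸ op_smul b v
  | add x y hx hy => exact add _ _ hx hy

variable {ρ} in
theorem ind_hom_ext {N : Type*} [AddCommGroup N] [Module (BrauerC K r δ)ᵐᵒᵖ N]
    {f g : ind K δ l ρ →ₗ[(BrauerC K r δ)ᵐᵒᵖ] N} (h : ∀ v, f (toInd ρ δ v) = g (toInd ρ δ v)) :
    f = g := by
  refine LinearMap.ext fun z => ?_
  induction z using ind_induction with
  | zero => rw [map_zero, map_zero]
  | add x y hx hy => rw [map_add, map_add, hx, hy]
  | op_smul b v => rw [map_smul, map_smul, h]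

variable {ρ} in
theorem op_smul_ind_of_mem_J {b : BrauerC K r δ} (hb : b ∈ J K r δ (l + 1))
    (z : ind K δ l ρ) : op b • z = 0 := by
  induction z using ind_induction with
  | zero => rw [smul_zero]
  | add x y hx hy => rw [smul_add, hx, hy, add_zero]
  | op_smul c v =>
    rw [smul_smul, ← op_mul, op_smul_toInd, toLayer_eq_zero_of_idem_mul_mem_J
      ((J K r δ (l + 1)).mul_mem_left _ _ ((J K r δ (l + 1)).mul_mem_left _ _ hb)),
      TensorProduct.zero_tmul]
    rfl

open scoped Classical in
/-- The map `x ⊗ v ↦ ∑ σ, c_σ v · σ`, where `c_σ` is the coefficient of `e_l σ` in `x`. -/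
noncomputable def contract (δ : K) (hl : l ≤ r) : Layer K r δ l ⊗[K] V →ₗ[K] V :=
  ∑ σ : Hyperoctahedral (r - l),
    TensorProduct.lift ((LinearMap.lsmul K V).compl₁₂ (layerCoeff δ hl σ) (ρ (op σ)))

open scoped Classical in
theorem contract_tmul (hl : l ≤ r) (x : Layer K r δ l) (v : V) :
    contract ρ δ hl (x ⊗ₜ v) =
      ∑ σ : Hyperoctahedral (r - l), layerCoeff δ hl σ x • ρ (op σ) v := by
  rw [contract, LinearMap.sum_apply]
  rfl

theorem contract_layerAct_tmul (hl : l ≤ r) (σ : Hyperoctahedral (r - l)) (x : Layer K r δ l)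
    (v : V) : contract ρ δ hl (layerAct K r δ l σ x ⊗ₜ v) =
      contract ρ δ hl (x ⊗ₜ ρ (op σ) v) := by
  classical
  rw [contract_tmul, contract_tmul]
  refine (Fintype.sum_equiv (Equiv.mulLeft σ) _ _ fun τ => ?_).symm
  rw [Equiv.coe_mulLeft, layerCoeff_layerAct, inv_mul_cancel_left, op_mul, map_mul]
  rfl

theorem balanced_le_ker_contract (hl : l ≤ r) :
    (balanced K δ l ρ).restrictScalars K ≤ LinearMap.ker (contract ρ δ hl) := by
  intro z hz
  rw [LinearMap.mem_ker]
  induction hz using Submodule.closure_induction with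
  | zero => exact map_zero _
  | add x y _ _ hx hy => rw [map_add, hx, hy, add_zero]
  | smul_mem b z hz =>
    obtain ⟨x, v, σ, rfl⟩ := hz
    rw [smul_sub, TensorProduct.smul_tmul', TensorProduct.smul_tmul', map_sub,
      ← LinearMap.map_smul, contract_layerAct_tmul, sub_self]

/-- The map from `ind_l V` to `V` induced by `contract`, a retraction of `toInd`. -/
noncomputable def fromInd (δ : K) (hl : l ≤ r) : ind K δ l ρ →ₗ[K] V :=
  ((balanced K δ l ρ).restrictScalars K).liftQ (contract ρ δ hl) (balanced_le_ker_contract ρ hl) ∘ₗ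
    (Submodule.Quotient.restrictScalarsEquiv K (balanced K δ l ρ)).symm.toLinearMap

theorem fromInd_toInd (hδ : δ ≠ 0) (hl : l ≤ r) (v : V) :
    fromInd ρ δ hl (toInd ρ δ v) = v := by
  classical
  change contract ρ δ hl (toLayer K r δ l 1 ⊗ₜ[K] v) = v
  simp only [contract_tmul, layerCoeff_toLayer_one hδ, ite_smul, one_smul, zero_smul,
    Finset.sum_ite_eq', Finset.mem_univ, if_true, op_one, map_one, Module.End.one_apply]

variable {ρ} in
theorem op_arcs_smul_mem_range_toInd (hl : l ≤ r) (z : ind K δ l ρ) :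
    op (basis δ (DiagramC.arcs r l)) • z ∈ LinearMap.range (toInd ρ δ) := by
  induction z using ind_induction with
  | zero => rw [smul_zero]; exact Submodule.zero_mem _
  | add x y hx hy => rw [smul_add]; exact Submodule.add_mem _ hx hy
  | op_smul b v =>
    rw [smul_smul, ← op_mul, op_smul_toInd]
    let tmulRight : Layer K r δ l →ₗ[K] ind K δ l ρ :=
      (balanced K δ l ρ).mkQ.restrictScalars K ∘ₗ (TensorProduct.mk K _ _).flip v
    have h : Submodule.span K
        (Set.range fun σ => toLayer K r δ l (ofHyperoctahedral K r δ l σ)) ≤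
        (LinearMap.range (toInd ρ δ)).comap tmulRight := by
      refine Submodule.span_le.2 (Set.range_subset_iff.2 fun σ => ⟨ρ (op σ) v, ?_⟩)
      rw [toInd_act, op_smul_toInd]
      rfl
    exact h (toLayer_mul_arcs_mem_span hl b)

theorem apply_toInd_mem_range_toInd (hδ : δ ≠ 0) (hl : l ≤ r) {W : Type*} [AddCommGroup W]
    [Module K W] {ρ' : Representation K (Hyperoctahedral (r - l))ᵐᵒᵖ W}
    (f : ind K δ l ρ →ₗ[(BrauerC K r δ)ᵐᵒᵖ] ind K δ l ρ') (v : V) :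
    f (toInd ρ δ v) ∈ LinearMap.range (toInd ρ' δ) := by
  obtain ⟨a, ha⟩ := exists_idem_mul_smul_arcs_eq_idem (K := K) (r := r) hδ l
  rw [← op_smul_toInd_of_idem_mul_eq ρ ha v, map_smul, op_smul, smul_assoc]
  exact Submodule.smul_mem _ _ (op_arcs_smul_mem_range_toInd hl _)

theorem exists_intertwiningMap_ne_zero (hδ : δ ≠ 0) (hl : l ≤ r) {W : Type*} [AddCommGroup W]
    [Module K W] {ρ' : Representation K (Hyperoctahedral (r - l))ᵐᵒᵖ W}
    {f : ind K δ l ρ →ₗ[(BrauerC K r δ)ᵐᵒᵖ] ind K δ l ρ'} (hf : f ≠ 0) :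
    ∃ F : Representation.IntertwiningMap ρ ρ', F ≠ 0 := by
  let F : V →ₗ[K] W := fromInd ρ' δ hl ∘ₗ f.restrictScalars K ∘ₗ toInd ρ δ
  have toInd_F (v : V) : toInd ρ' δ (F v) = f (toInd ρ δ v) := by
    obtain ⟨w, hw⟩ := apply_toInd_mem_range_toInd ρ hδ hl f v
    change toInd ρ' δ (fromInd ρ' δ hl (f (toInd ρ δ v))) = _
    rw [← hw, fromInd_toInd ρ' hδ]
  have hF (σ : (Hyperoctahedral (r - l))ᵐᵒᵖ) (v : V) : F (ρ σ v) = ρ' σ (F v) := by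
    refine Function.LeftInverse.injective (fromInd_toInd ρ' hδ hl) ?_
    rw [toInd_F, ← op_unop σ, toInd_act, toInd_act, map_smul, toInd_F]
  refine ⟨LinearMap.intertwiningMap_of_isIntertwiningMap ρ ρ' F hF, fun h => hf ?_⟩
  have F_eq_zero (v : V) : F v = 0 :=
    congrArg (fun G : Representation.IntertwiningMap ρ ρ' => G v) h
  refine ind_hom_ext fun v => ?_
  rw [← toInd_F, F_eq_zero, map_zero, LinearMap.zero_apply]

theorem ind_hom_eq_zero_of_lt (hδ : δ ≠ 0) (hl : l ≤ r) {m : ℕ} (hm : m < l)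
    {U : Type*} [AddCommGroup U] [Module K U]
    {ρ' : Representation K (Hyperoctahedral (r - m))ᵐᵒᵖ U}
    (f : ind K δ l ρ →ₗ[(BrauerC K r δ)ᵐᵒᵖ] ind K δ m ρ') : f = 0 := by
  obtain ⟨a, ha⟩ := exists_idem_mul_smul_arcs_eq_idem (K := K) (r := r) hδ l
  refine ind_hom_ext fun v => ?_
  rw [← op_smul_toInd_of_idem_mul_eq ρ ha v, map_smul, LinearMap.zero_apply]
  refine op_smul_ind_of_mem_J (smul_mem_J a (basis_mem_J ?_)) _
  rw [DiagramC.numArcs_arcs hl]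
  exact hm

end Induction

end BrauerC

theorem mainTheorem8_general {K : Type*} [Field K] (hK : ringChar K ≠ 2) {r : ℕ} {δ : K}
    (hδ : δ ≠ 0) {x y : CellIndex r}
    {f : CellModule K δ x →ₗ[(BrauerC K r δ)ᵐᵒᵖ] CellModule K δ y} (hf : f ≠ 0) : y ≤ x := by
  obtain ⟨l, hl, lam⟩ := x
  obtain ⟨m, hm, mu⟩ := y
  rcases lt_trichotomy l m with hlm | rfl | hml
  · exact .inl hlm
  · obtain ⟨F, hF⟩ := BrauerC.exists_intertwiningMap_ne_zero _ hδ hl hf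
    exact .inr ⟨rfl, dominates_of_intertwiningMap_ne_zero hK hF⟩
  · exact absurd (BrauerC.ind_hom_eq_zero_of_lt _ hδ hl hml f) hf

theorem mainTheorem8 {K : Type*} [Field K] [IsAlgClosed K] (hK : ringChar K ≠ 2)
    (r : ℕ) (δ : K) (hδ : δ ≠ 0) (x y : CellIndex r) (hxy : x < y)
    (f : CellModule K δ x →ₗ[(BrauerC K r δ)ᵐᵒᵖ] CellModule K δ y) : f = 0 :=
  by_contra fun hf => hxy.not_ge (mainTheorem8_general hK hδ hf)
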